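/- Work in homotopy type theory (HoTT): intensional Martin-Löf type theory with $\Pi$, $\Sigma$, $\mathrm{Id}$, $\mathbf 0$, $\mathbf 1$, $+$, a cumulative hierarchy of univalent universes, function extensionality and propositional truncation $\|-\|$. Fix a universe $\mathcal U$. A type has h-level $0$ if it is contractible, and h-level $m+1$ if all its identity types have h-level $m$; $\mathcal U^{m}$ denotes the type of types of h-level $m$ in $\mathcal U$, $\mathbf{Prop}_{\mathcal U}=\mathcal U^{1}$ and $\mathbf{Set}_{\mathcal U}=\mathcal U^{2}$. A precategory consists of a type $C:\mathcal U$, a family $\mathrm{Hom}:C\to C\to\mathbf{Set}_{\mathcal U}$, identities $1:\Pi_{a:C}\,\mathrm{Hom}(a,a)$, a composition $\Pi_{a,b,c:C}\,\mathrm{Hom}(a,b)\to\mathrm{Hom}(b,c)\to\mathrm{Hom}(a,c)$, and proofs of associativity and of the two unit laws. A strict category is a precategory whose type of objects $C$ is an h-set; $\mathbf{StrCat}$ is the type of strict categories. Let $\mathcal L_{\mathrm{strcat}}$ be the signature of first-order logic with isomorphism with sorts $O$, $A$, $I$, $\circ$, $\cong_A$, of h-levels $2,2,1,1,1$ respectively,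 generated by arrows $d,c:A\to O$; $i:I\to A$; $t_0,t_1,t_2:\circ\to A$; $s,t:{\cong_A}\to A$, subject to $di=ci$; $dt_0=dt_2$, $ct_1=ct_2$, $dt_1=ct_0$; $ds=dt$, $cs=ct$; the sort $\cong_A$ is the isomorphism sort of $A$ (interpreted by identity types). Thus a homotopy $\mathcal L_{\mathrm{strcat}}$-structure consists of $O:\mathbf{Set}_{\mathcal U}$, $A:O\to O\to\mathbf{Set}_{\mathcal U}$, $I:\Pi_{x:O}\,A(x,x)\to\mathbf{Prop}_{\mathcal U}$ and $\circ:\Pi_{x,y,z:O}\,A(x,y)\to A(y,z)\to A(x,z)\to\mathbf{Prop}_{\mathcal U}$. Let $\mathbb T_{\mathrm{strcat}}$ be the theory with the following axioms, in which a sort expression used as a formula abbreviates the formula stating that it is inhabited. 1. $\forall x:O.\ \exists i:A(x,x).\ I(i)$ 2. $\forall x,y,z:O.\ \forall f:A(x,y).\ \forall g:A(y,z).\ \exists h:A(x,z).\ \circ(f,g,h)$ 3. $\forall x,y,z:O.\ \forall f:A(x,y).\ \forall g:A(y,z).\ \forall h,h':A(x,z).\ \forall \tau_1:\circ(f,g,h).\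 \forall\tau_2:\circ(f,g,h').\ h\cong_A h'$ 4. $\forall x,y,z,w:O.\ \forall f:A(x,y).\ \forall g:A(y,z).\ \forall h:A(z,w).\ \forall i:A(x,z).\ \forall j:A(x,w).\ \forall k:A(y,w).\ \forall\tau_1:\circ(f,g,i).\ \forall\tau_2:\circ(i,h,j).\ \forall\tau_3:\circ(g,h,k).\ \circ(f,k,j)$ 5. $\forall x:O.\ \forall i,j:A(x,x).\ \forall\sigma_1:I(i).\ \forall\sigma_2:I(j).\ i\cong_A j$ 6. $\forall x,y:O.\ \forall i:A(x,x).\ \forall g:A(x,y).\ \forall\sigma:I(i).\ \circ(i,g,g)$ 7. $\forall x,y:O.\ \forall i:A(y,y).\ \forall f:A(x,y).\ \forall\sigma:I(i).\ \circ(f,i,f)$ Let $\mathbf{Mod}(\mathbb T_{\mathrm{strcat}})$ be its type of models, i.e. the $\Sigma$-type of homotopy $\mathcal L_{\mathrm{strcat}}$-structures together with proofs of the interpretations of all axioms, where $\forall$ is interpreted by $\Pi$ and $\exists$ by the propositional truncation of $\Sigma$. Then there is an equivalence of types in HoTT $$\mathbf{StrCat}\ \simeq\ \mathbf{Mod}(\mathbb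 T_{\mathrm{strcat}}),$$ that is, for every universe $\mathcal U$ of the hierarchy, HoTT derives a closed term of the type of equivalences from $\mathbf{StrCat}$ to $\mathbf{Mod}(\mathbb T_{\mathrm{strcat}})$. -/

import Mathlib

open CategoryTheory

namespace HoTT

/-! # The formal system of homotopy type theory

Raw terms with de Bruijn indices.  A universe hierarchy `U₀ : U₁ : …`, the type formers
`Π, Σ, 0, 1, +, Id`, propositional truncation, function extensionality and univalence. -/

/-- Raw terms.  The comments give the number of variables bound in each argument (if any). -/
inductive Tm : Type
  | var (n : ℕ)
  | univ (i : ℕ)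
  /-- `Π (x : A), B`; one variable is bound in `B`. -/
  | pi (A B : Tm)
  /-- `λ (x : A), b`; one variable is bound in `b`. -/
  | lam (A b : Tm)
  | app (f a : Tm)
  /-- `Σ (x : A), B`; one variable is bound in `B`. -/
  | sig (A B : Tm)
  | pair (a b : Tm)
  /-- `Σ`-induction `ind (z. C) (x. y. g) p`. -/
  | sigInd (C g p : Tm)
  | unit
  | star
  /-- `1`-induction `ind (z. C) c a`. -/
  | unitInd (C c a : Tm)
  | empty
  /-- `0`-induction `ind (z. C) a`. -/
  | emptyInd (C a : Tm)
  | sum (A B : Tm)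
  | inl (a : Tm)
  | inr (b : Tm)
  /-- `+`-induction `ind (z. C) (x. c) (y. d) e`. -/
  | sumInd (C c d e : Tm)
  /-- The identity type of `a` and `b` in `A`. -/
  | id (A a b : Tm)
  | refl (a : Tm)
  /-- Path induction `ind (x. y. p. C) (z. c) a b p`. -/
  | idInd (C c a b p : Tm)
  /-- The propositional truncation of `A`. -/
  | trunc (A : Tm)
  | truncIn (a : Tm)
  /-- The path between two points of a truncation. -/
  | truncPath (a b : Tm)
  /-- Truncation recursion into `B`, with `w` witnessing that `B` is a mere proposition. -/
  | truncRec (B w f t : Tm)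
  /-- The constant of the function extensionality axiom for `f g : Π (x : A), B`. -/
  | funext (A B f g : Tm)
  /-- The constant of the univalence axiom for `A B : Uᵢ`. -/
  | univalence (i : ℕ) (A B : Tm)

namespace Tm

/-- Extend a renaming under one binder. -/
def upRen (r : ℕ → ℕ) : ℕ → ℕ
  | 0 => 0
  | n + 1 => r n + 1

/-- Renaming of free variables. -/
def rename : (ℕ → ℕ) → Tm → Tm
  | r, var n => var (r n)
  | _, univ i => univ i
  | r, pi A B => pi (rename r A) (rename (upRen r) B)
  | r, lam A b => lam (rename r A) (rename (upRen r) b)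
  | r, app f a => app (rename r f) (rename r a)
  | r, sig A B => sig (rename r A) (rename (upRen r) B)
  | r, pair a b => pair (rename r a) (rename r b)
  | r, sigInd C g p =>
      sigInd (rename (upRen r) C) (rename (upRen (upRen r)) g) (rename r p)
  | _, unit => unit
  | _, star => star
  | r, unitInd C c a => unitInd (rename (upRen r) C) (rename r c) (rename r a)
  | _, empty => empty
  | r, emptyInd C a => emptyInd (rename (upRen r) C) (rename r a)
  | r, sum A B => sum (rename r A) (rename r B)
  | r, inl a => inl (rename r a)
  | r, inr b => inr (rename r b)
  | r, sumInd C c d e =>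
      sumInd (rename (upRen r) C) (rename (upRen r) c) (rename (upRen r) d) (rename r e)
  | r, id A a b => id (rename r A) (rename r a) (rename r b)
  | r, refl a => refl (rename r a)
  | r, idInd C c a b p =>
      idInd (rename (upRen (upRen (upRen r))) C) (rename (upRen r) c)
        (rename r a) (rename r b) (rename r p)
  | r, trunc A => trunc (rename r A)
  | r, truncIn a => truncIn (rename r a)
  | r, truncPath a b => truncPath (rename r a) (rename r b)
  | r, truncRec B w f t => truncRec (rename r B) (rename r w) (rename r f) (rename r t)
  | r, funext A B f g =>
      funext (rename r A) (rename (upRen r) B) (rename r f) (rename r g)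
  | r, univalence i A B => univalence i (rename r A) (rename r B)

/-- Weakening by `k` variables. -/
def shift (k : ℕ) (t : Tm) : Tm := rename (fun n => n + k) t

/-- Extend a substitution under one binder. -/
def up (s : ℕ → Tm) : ℕ → Tm
  | 0 => var 0
  | n + 1 => shift 1 (s n)

/-- Simultaneous capture-avoiding substitution. -/
def subst : (ℕ → Tm) → Tm → Tm
  | s, var n => s n
  | _, univ i => univ i
  | s, pi A B => pi (subst s A) (subst (up s) B)
  | s, lam A b => lam (subst s A) (subst (up s) b)
  | s, app f a => app (subst s f) (subst s a)
  | s, sig A B => sig (subst s A) (subst (up s) B)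
  | s, pair a b => pair (subst s a) (subst s b)
  | s, sigInd C g p => sigInd (subst (up s) C) (subst (up (up s)) g) (subst s p)
  | _, unit => unit
  | _, star => star
  | s, unitInd C c a => unitInd (subst (up s) C) (subst s c) (subst s a)
  | _, empty => empty
  | s, emptyInd C a => emptyInd (subst (up s) C) (subst s a)
  | s, sum A B => sum (subst s A) (subst s B)
  | s, inl a => inl (subst s a)
  | s, inr b => inr (subst s b)
  | s, sumInd C c d e =>
      sumInd (subst (up s) C) (subst (up s) c) (subst (up s) d) (subst s e)
  | s, id A a b => id (subst s A) (subst s a) (subst s b)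
  | s, refl a => refl (subst s a)
  | s, idInd C c a b p =>
      idInd (subst (up (up (up s))) C) (subst (up s) c) (subst s a) (subst s b) (subst s p)
  | s, trunc A => trunc (subst s A)
  | s, truncIn a => truncIn (subst s a)
  | s, truncPath a b => truncPath (subst s a) (subst s b)
  | s, truncRec B w f t => truncRec (subst s B) (subst s w) (subst s f) (subst s t)
  | s, funext A B f g => funext (subst s A) (subst (up s) B) (subst s f) (subst s g)
  | s, univalence i A B => univalence i (subst s A) (subst s B)

/-- `a, s`: the substitution with `0 ↦ a` and `n + 1 ↦ s n`. -/
def scons (a : Tm) (s : ℕ → Tm) : ℕ → Tm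
  | 0 => a
  | n + 1 => s n

/-- `B[a]`. -/
def inst (B a : Tm) : Tm := subst (scons a var) B

/-- `B[a, b]`, the last bound variable being replaced by `b`. -/
def inst₂ (B a b : Tm) : Tm := subst (scons b (scons a var)) B

/-- `B[a, b, c]`, the last bound variable being replaced by `c`. -/
def inst₃ (B a b c : Tm) : Tm := subst (scons c (scons b (scons a var))) B

end Tm

/-! ## Notation with named binders

A `PTm` is a term expression that can be placed under any number `d` of binders.  This allows to
write closed types of the theory with bound variables named by Lean variables. -/

/-- A term expression, as a function of the number of binders above it. -/
abbrev PTm : Type := ℕ → Tm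

namespace PTm

/-- The variable bound by the binder with `d` binders above it. -/
def bvar (d : ℕ) : PTm := fun d' => .var (d' - (d + 1))

/-- A raw term over some context, regarded as a term expression over that context. -/
def ofTm (t : Tm) : PTm := fun d => t.shift d

/-- A raw type family with one bound variable, as an operation on term expressions. -/
def ofFam (B : Tm) (x : PTm) : PTm :=
  fun d => B.subst (Tm.scons (x d) fun n => .var (n + d))

def univ (i : ℕ) : PTm := fun _ => .univ i
def pi (A : PTm) (B : PTm → PTm) : PTm := fun d => .pi (A d) (B (bvar d) (d + 1))
def lam (A : PTm) (b : PTm → PTm) : PTm := fun d => .lam (A d) (b (bvar d) (d + 1))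
def app (f a : PTm) : PTm := fun d => .app (f d) (a d)
def sig (A : PTm) (B : PTm → PTm) : PTm := fun d => .sig (A d) (B (bvar d) (d + 1))
def pair (a b : PTm) : PTm := fun d => .pair (a d) (b d)
def unit : PTm := fun _ => .unit
def empty : PTm := fun _ => .empty
def sum (A B : PTm) : PTm := fun d => .sum (A d) (B d)
def id (A a b : PTm) : PTm := fun d => .id (A d) (a d) (b d)
def refl (a : PTm) : PTm := fun d => .refl (a d)
def trunc (A : PTm) : PTm := fun d => .trunc (A d)
def idInd (C : PTm → PTm → PTm → PTm) (c : PTm → PTm) (a b p : PTm) : PTm := fun d =>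
  .idInd (C (bvar d) (bvar (d + 1)) (bvar (d + 2)) (d + 3)) (c (bvar d) (d + 1))
    (a d) (b d) (p d)

/-- Non-dependent functions. -/
def arrow (A B : PTm) : PTm := pi A fun _ => B

/-- Non-dependent pairs. -/
def prod (A B : PTm) : PTm := sig A fun _ => B

/-- The first projection `(Σ (x : A), B x) → A`, applied to `p`. -/
def fst (A p : PTm) : PTm := fun d => .sigInd (A (d + 1)) (.var 1) (p d)

/-- Iterated application. -/
def apps (f : PTm) (as : List PTm) : PTm := as.foldl app f

/-- `isequiv f`: the map `f : A → B` has a right inverse and a left inverse. -/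
def isEquiv (A B f : PTm) : PTm :=
  prod
    (sig (arrow B A) fun g => pi B fun b => id B (app f (app g b)) b)
    (sig (arrow B A) fun k => pi A fun a => id A (app k (app f a)) a)

/-- The type `A ≃ B` of equivalences. -/
def equiv (A B : PTm) : PTm := sig (arrow A B) fun f => isEquiv A B f

/-- The identity equivalence. -/
def idEquiv (A : PTm) : PTm :=
  pair (lam A fun x => x)
    (pair (pair (lam A fun x => x) (lam A fun x => refl x))
      (pair (lam A fun x => x) (lam A fun x => refl x)))

/-- The map `(f = g) → Π (x : A), f x = g x` for `f g : Π (x : A), B x`. -/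
def happly (A : PTm) (B : PTm → PTm) (f g : PTm) : PTm :=
  lam (id (pi A B) f g) fun p =>
    idInd (fun u v _ => pi A fun x => id (B x) (app u x) (app v x))
      (fun u => lam A fun x => refl (app u x)) f g p

/-- The map `(A = B) → (A ≃ B)` for `A B : Uᵢ`. -/
def idToEquiv (i : ℕ) (A B : PTm) : PTm :=
  lam (id (univ i) A B) fun p => idInd (fun X Y _ => equiv X Y) (fun X => idEquiv X) A B p

/-- Transport of `u : P a` along `p : a = b` in `A`. -/
def transport (P : PTm → PTm) (a b p u : PTm) : PTm :=
  app (idInd (fun x y _ => arrow (P x) (P y)) (fun x => lam (P x) fun v => v) a b p) u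

/-- Mere propositions in the form `Π (x y : A), x = y`. -/
def isProp (A : PTm) : PTm := pi A fun x => pi A fun y => id A x y

/-- The type expressing that `A` is contractible. -/
def isContr (A : PTm) : PTm := sig A fun x => pi A fun y => id A x y

/-- The type expressing that `A` has h-level `m`
(`0` contractible, `1` mere proposition, `2` set, `3` groupoid, …). -/
def isOfHLevel : ℕ → PTm → PTm
  | 0, A => isContr A
  | m + 1, A => pi A fun x => pi A fun y => isOfHLevel m (id A x y)

/-- The type of types of h-level `m` in `Uᵢ`, which is `Uᵢ` itself for `m = ∞`. -/
def typesOfHLevel (i : ℕ) : WithTop ℕ → PTm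
  | none => univ i
  | some m => sig (univ i) fun X => isOfHLevel m X

/-- The underlying type of a type of h-level `m` in `Uᵢ`. -/
def el (i : ℕ) : WithTop ℕ → PTm → PTm
  | none, X => X
  | some _, X => fst (univ i) X

end PTm

/-! ## Convertibility and typing -/

/-- Judgmental equality, as convertibility of raw terms: the congruence generated by the
computation rules and by the uniqueness rule for functions. -/
inductive Conv : Tm → Tm → Prop
  | refl (a) : Conv a a
  | symm {a b} : Conv a b → Conv b a
  | trans {a b c} : Conv a b → Conv b c → Conv a c
  | beta (A b a) : Conv (.app (.lam A b) a) (b.inst a)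
  | eta (A f) : Conv (.lam A (.app (f.shift 1) (.var 0))) f
  | sigBeta (C g a b) : Conv (.sigInd C g (.pair a b)) (g.inst₂ a b)
  | unitBeta (C c) : Conv (.unitInd C c .star) c
  | inlBeta (C c d a) : Conv (.sumInd C c d (.inl a)) (c.inst a)
  | inrBeta (C c d b) : Conv (.sumInd C c d (.inr b)) (d.inst b)
  | idBeta (C c a b x) : Conv (.idInd C c a b (.refl x)) (c.inst x)
  | truncBeta (B w f a) : Conv (.truncRec B w f (.truncIn a)) (.app f a)
  | pi {A A' B B'} : Conv A A' → Conv B B' → Conv (.pi A B) (.pi A' B')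
  | lam {A A' b b'} : Conv A A' → Conv b b' → Conv (.lam A b) (.lam A' b')
  | app {f f' a a'} : Conv f f' → Conv a a' → Conv (.app f a) (.app f' a')
  | sig {A A' B B'} : Conv A A' → Conv B B' → Conv (.sig A B) (.sig A' B')
  | pair {a a' b b'} : Conv a a' → Conv b b' → Conv (.pair a b) (.pair a' b')
  | sigInd {C C' g g' p p'} : Conv C C' → Conv g g' → Conv p p' →
      Conv (.sigInd C g p) (.sigInd C' g' p')
  | unitInd {C C' c c' a a'} : Conv C C' → Conv c c' → Conv a a' →
      Conv (.unitInd C c a) (.unitInd C' c' a')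
  | emptyInd {C C' a a'} : Conv C C' → Conv a a' → Conv (.emptyInd C a) (.emptyInd C' a')
  | sum {A A' B B'} : Conv A A' → Conv B B' → Conv (.sum A B) (.sum A' B')
  | inl {a a'} : Conv a a' → Conv (.inl a) (.inl a')
  | inr {b b'} : Conv b b' → Conv (.inr b) (.inr b')
  | sumInd {C C' c c' d d' e e'} : Conv C C' → Conv c c' → Conv d d' → Conv e e' →
      Conv (.sumInd C c d e) (.sumInd C' c' d' e')
  | id {A A' a a' b b'} : Conv A A' → Conv a a' → Conv b b' →
      Conv (.id A a b) (.id A' a' b')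
  | reflCongr {a a'} : Conv a a' → Conv (.refl a) (.refl a')
  | idInd {C C' c c' a a' b b' p p'} : Conv C C' → Conv c c' → Conv a a' → Conv b b' →
      Conv p p' → Conv (.idInd C c a b p) (.idInd C' c' a' b' p')
  | trunc {A A'} : Conv A A' → Conv (.trunc A) (.trunc A')
  | truncIn {a a'} : Conv a a' → Conv (.truncIn a) (.truncIn a')
  | truncPath {a a' b b'} : Conv a a' → Conv b b' → Conv (.truncPath a b) (.truncPath a' b')
  | truncRec {B B' w w' f f' t t'} : Conv B B' → Conv w w' → Conv f f' → Conv t t' →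
      Conv (.truncRec B w f t) (.truncRec B' w' f' t')
  | funext {A A' B B' f f' g g'} : Conv A A' → Conv B B' → Conv f f' → Conv g g' →
      Conv (.funext A B f g) (.funext A' B' f' g')
  | univalence {i A A' B B'} : Conv A A' → Conv B B' →
      Conv (.univalence i A B) (.univalence i A' B')

mutual

/-- `Γ ctx`: well-formed contexts.  The last variable of a context is the head of the list. -/
inductive IsCtx : List Tm → Prop
  | nil : IsCtx []
  | cons {Γ A i} : HasType Γ A (.univ i) → IsCtx (A :: Γ)

/-- `Γ ⊢ a : A`. -/
inductive HasType : List Tm → Tm → Tm → Prop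
  | var {Γ n A} : IsCtx Γ → Γ[n]? = some A → HasType Γ (.var n) (A.shift (n + 1))
  | conv {Γ a A B i} : HasType Γ a A → HasType Γ B (.univ i) → Conv A B → HasType Γ a B
  | univ {Γ} (i) : IsCtx Γ → HasType Γ (.univ i) (.univ (i + 1))
  | cumul {Γ A i} : HasType Γ A (.univ i) → HasType Γ A (.univ (i + 1))
  | pi {Γ A B i} : HasType Γ A (.univ i) → HasType (A :: Γ) B (.univ i) →
      HasType Γ (.pi A B) (.univ i)
  | lam {Γ A b B i} : HasType Γ A (.univ i) → HasType (A :: Γ) b B →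
      HasType Γ (.lam A b) (.pi A B)
  | app {Γ f a A B} : HasType Γ f (.pi A B) → HasType Γ a A → HasType Γ (.app f a) (B.inst a)
  | sig {Γ A B i} : HasType Γ A (.univ i) → HasType (A :: Γ) B (.univ i) →
      HasType Γ (.sig A B) (.univ i)
  | pair {Γ a b A B i} : HasType Γ A (.univ i) → HasType (A :: Γ) B (.univ i) →
      HasType Γ a A → HasType Γ b (B.inst a) → HasType Γ (.pair a b) (.sig A B)
  | sigInd {Γ A B C g p i} : HasType (.sig A B :: Γ) C (.univ i) →
      HasType (B :: A :: Γ) g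
        (C.subst (Tm.scons (.pair (.var 1) (.var 0)) fun n => .var (n + 2))) →
      HasType Γ p (.sig A B) → HasType Γ (.sigInd C g p) (C.inst p)
  | unit {Γ} (i) : IsCtx Γ → HasType Γ .unit (.univ i)
  | star {Γ} : IsCtx Γ → HasType Γ .star .unit
  | unitInd {Γ C c a i} : HasType (.unit :: Γ) C (.univ i) → HasType Γ c (C.inst .star) →
      HasType Γ a .unit → HasType Γ (.unitInd C c a) (C.inst a)
  | empty {Γ} (i) : IsCtx Γ → HasType Γ .empty (.univ i)
  | emptyInd {Γ C a i} : HasType (.empty :: Γ) C (.univ i) → HasType Γ a .empty →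
      HasType Γ (.emptyInd C a) (C.inst a)
  | sum {Γ A B i} : HasType Γ A (.univ i) → HasType Γ B (.univ i) →
      HasType Γ (.sum A B) (.univ i)
  | inl {Γ a A B i} : HasType Γ A (.univ i) → HasType Γ B (.univ i) → HasType Γ a A →
      HasType Γ (.inl a) (.sum A B)
  | inr {Γ b A B i} : HasType Γ A (.univ i) → HasType Γ B (.univ i) → HasType Γ b B →
      HasType Γ (.inr b) (.sum A B)
  | sumInd {Γ A B C c d e i} : HasType (.sum A B :: Γ) C (.univ i) →
      HasType (A :: Γ) c (C.subst (Tm.scons (.inl (.var 0)) fun n => .var (n + 1))) →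
      HasType (B :: Γ) d (C.subst (Tm.scons (.inr (.var 0)) fun n => .var (n + 1))) →
      HasType Γ e (.sum A B) → HasType Γ (.sumInd C c d e) (C.inst e)
  | id {Γ A a b i} : HasType Γ A (.univ i) → HasType Γ a A → HasType Γ b A →
      HasType Γ (.id A a b) (.univ i)
  | refl {Γ A a i} : HasType Γ A (.univ i) → HasType Γ a A →
      HasType Γ (.refl a) (.id A a a)
  | idInd {Γ A C c a b p i} :
      HasType (.id (A.shift 2) (.var 1) (.var 0) :: A.shift 1 :: A :: Γ) C (.univ i) →
      HasType (A :: Γ) c (C.subst (Tm.scons (.refl (.var 0)) (Tm.scons (.var 0)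
        (Tm.scons (.var 0) fun n => .var (n + 1))))) →
      HasType Γ a A → HasType Γ b A → HasType Γ p (.id A a b) →
      HasType Γ (.idInd C c a b p) (C.inst₃ a b p)
  | trunc {Γ A i} : HasType Γ A (.univ i) → HasType Γ (.trunc A) (.univ i)
  | truncIn {Γ A a i} : HasType Γ A (.univ i) → HasType Γ a A →
      HasType Γ (.truncIn a) (.trunc A)
  | truncPath {Γ A a b} : HasType Γ a (.trunc A) → HasType Γ b (.trunc A) →
      HasType Γ (.truncPath a b) (.id (.trunc A) a b)
  | truncRec {Γ A B w f t i} : HasType Γ B (.univ i) →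
      HasType Γ w (PTm.isProp (PTm.ofTm B) 0) → HasType Γ f (.pi A (B.shift 1)) →
      HasType Γ t (.trunc A) → HasType Γ (.truncRec B w f t) B
  | funext {Γ A B f g i} : HasType Γ A (.univ i) → HasType (A :: Γ) B (.univ i) →
      HasType Γ f (.pi A B) → HasType Γ g (.pi A B) →
      HasType Γ (.funext A B f g)
        (PTm.isEquiv
          (PTm.id (PTm.ofTm (.pi A B)) (PTm.ofTm f) (PTm.ofTm g))
          (PTm.pi (PTm.ofTm A) fun x =>
            PTm.id (PTm.ofFam B x) (PTm.app (PTm.ofTm f) x) (PTm.app (PTm.ofTm g) x))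
          (PTm.happly (PTm.ofTm A) (PTm.ofFam B) (PTm.ofTm f) (PTm.ofTm g)) 0)
  | univalence {Γ A B i} : HasType Γ A (.univ i) → HasType Γ B (.univ i) →
      HasType Γ (.univalence i A B)
        (PTm.isEquiv
          (PTm.id (PTm.univ i) (PTm.ofTm A) (PTm.ofTm B))
          (PTm.equiv (PTm.ofTm A) (PTm.ofTm B))
          (PTm.idToEquiv i (PTm.ofTm A) (PTm.ofTm B)) 0)

end

/-- The closed type `A` is inhabited: `⊢ a : A` is derivable for some term `a`. -/
def IsInhabited (A : PTm) : Prop := ∃ a : Tm, HasType [] a (A 0)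

end HoTT

namespace FOLiso

open HoTT

/-! # Signatures of first-order logic with isomorphism -/

/-- The arrows of a category with domain `K`. -/
abbrev Arr {Ob : Type} [Category.{0} Ob] (K : Ob) : Type := Σ K' : Ob, (K ⟶ K')

namespace Arr

variable {Ob : Type} [Category.{0} Ob] {K : Ob}

/-- The arrow is an identity. -/
def IsId (f : Arr K) : Prop := f = ⟨K, 𝟙 K⟩

/-- The arrow `p ∘ f`. -/
def comp (f : Arr K) (p : Arr f.1) : Arr K := ⟨p.1, f.2 ≫ p.2⟩

/-- A non-identity arrow that is not the composite of two non-identity arrows. -/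
def IsTop (f : Arr K) : Prop :=
  ¬ f.IsId ∧ ∀ (k : Arr K) (p : Arr k.1), k.comp p = f → k.IsId ∨ p.IsId

end Arr

/-- A finite FOLDS signature: a finite inverse category with a proper order.  The order is given
by listing the objects, and for each object the non-identity arrows out of it, increasingly. -/
structure FOLDSSignature where
  Ob : Type
  [cat : Category.{0} Ob]
  [decOb : DecidableEq Ob]
  [decArr : ∀ K : Ob, DecidableEq (Arr K)]
  /-- All objects, in increasing order. -/
  objs : List Ob
  /-- The non-identity arrows out of an object, in increasing order. -/
  fan : (K : Ob) → List (Arr K)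
  endo : ∀ (K : Ob) (f : K ⟶ K), f = 𝟙 K
  skeletal : Skeletal Ob
  mem_objs : ∀ K : Ob, K ∈ objs
  nodup_objs : objs.Nodup
  mem_fan : ∀ (K : Ob) (f : Arr K), f ∈ fan K ↔ ¬ f.IsId
  nodup_fan : ∀ K : Ob, (fan K).Nodup
  /-- If there is a non-identity arrow `K ⟶ K'`, then `K' < K`. -/
  order_objs : ∀ (K : Ob), ∀ f ∈ fan K, objs.idxOf f.1 < objs.idxOf K
  /-- If `cod f < cod g` then `f < g`. -/
  order_fan : ∀ K : Ob, (fan K).Pairwise fun f g => objs.idxOf f.1 ≤ objs.idxOf g.1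

attribute [instance] FOLDSSignature.cat FOLDSSignature.decOb FOLDSSignature.decArr

/-- The role of a sort `K` of a signature: non-logical, or one of the three kinds of logical
sorts, together with the structure arrows out of it. -/
inductive SortKind {Ob : Type} [Category.{0} Ob] (K : Ob) : Type
  | nonlogical
  /-- `K` is the isomorphism sort of `A`, with source and target maps `s` and `t`. -/
  | iso (A : Ob) (s t : K ⟶ A)
  /-- `K` is the reflexivity predicate on the isomorphism sort `E` of `A`. -/
  | rho (A E : Ob) (s t : E ⟶ A) (r : K ⟶ E)
  /-- `K` is the transport structure of `A` in position `f : A ⟶ B`, along the paths in the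
  isomorphism sort `E` of `B`. -/
  | tau (A B E : Ob) (f : A ⟶ B) (s t : E ⟶ B) (e : K ⟶ E) (f₁ f₂ : K ⟶ A)

/-- A finite h-signature: a finite FOLDS signature, some of whose sorts are marked as logical,
with an assignment of h-levels. -/
structure HSignature extends FOLDSSignature where
  kind : (K : Ob) → SortKind K
  hlevel : Ob → WithTop ℕ
  iso_cond : ∀ (K A : Ob) (s t : K ⟶ A), kind K = .iso A s t →
    2 ≤ hlevel A ∧ s ≠ t ∧ (∀ f : K ⟶ A, f = s ∨ f = t) ∧
    (∀ f : Arr K, f.IsTop ↔ f = ⟨A, s⟩ ∨ f = ⟨A, t⟩) ∧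
    (∀ f : Arr A, ¬ f.IsId → s ≫ f.2 = t ≫ f.2) ∧
    hlevel K = hlevel A - 1
  rho_cond : ∀ (K A E : Ob) (s t : E ⟶ A) (r : K ⟶ E), kind K = .rho A E s t r →
    kind E = .iso A s t ∧ 2 ≤ hlevel A ∧ (∀ f : K ⟶ E, f = r) ∧
    (∀ f : Arr K, f.IsTop ↔ f = ⟨E, r⟩) ∧
    r ≫ s = r ≫ t ∧
    hlevel K = hlevel A - 2
  tau_cond : ∀ (K A B E : Ob) (f : A ⟶ B) (s t : E ⟶ B) (e : K ⟶ E) (f₁ f₂ : K ⟶ A),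
    kind K = .tau A B E f s t e f₁ f₂ →
    kind E = .iso B s t ∧ 3 ≤ hlevel B ∧ Arr.IsTop ⟨B, f⟩ ∧ f₁ ≠ f₂ ∧
    (∀ g : K ⟶ E, g = e) ∧ (∀ g : K ⟶ A, g = f₁ ∨ g = f₂) ∧
    (∀ g : Arr K, g.IsTop ↔ g = ⟨E, e⟩ ∨ g = ⟨A, f₁⟩ ∨ g = ⟨A, f₂⟩) ∧
    e ≫ s = f₁ ≫ f ∧ e ≫ t = f₂ ≫ f ∧
    (∀ g : Arr A, ¬ g.IsId → g ≠ ⟨B, f⟩ → f₁ ≫ g.2 = f₂ ≫ g.2) ∧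
    (∀ q : Arr B, ¬ q.IsId → f₁ ≫ f ≫ q.2 = f₂ ≫ f ≫ q.2) ∧
    hlevel K = hlevel A - 1
  /-- There is at most one isomorphism sort of each `A`, one reflexivity predicate, and one
  transport structure for each `f`. -/
  iso_unique : ∀ (K K' A : Ob) (s t : K ⟶ A) (s' t' : K' ⟶ A),
    kind K = .iso A s t → kind K' = .iso A s' t' → K = K'
  rho_unique : ∀ (K K' A E : Ob) (s t : E ⟶ A) (r : K ⟶ E) (r' : K' ⟶ E),
    kind K = .rho A E s t r → kind K' = .rho A E s t r' → K = K'
  tau_unique : ∀ (K K' A B E : Ob) (f : A ⟶ B) (s t : E ⟶ B) (e : K ⟶ E) (f₁ f₂ : K ⟶ A)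
    (e' : K' ⟶ E) (f₁' f₂' : K' ⟶ A),
    kind K = .tau A B E f s t e f₁ f₂ → kind K' = .tau A B E f s t e' f₁' f₂' → K = K'
  /-- Only reflexivity predicates may have h-level `0`. -/
  hlevel_zero : ∀ K : Ob, hlevel K = 0 → ∃ A E s t r, kind K = .rho A E s t r

/-! # Formulas -/

/-- Sort expressions `K (x_f)`, with a list of variables indexed by the non-identity arrows out
of `K` in increasing order. -/
structure SortExpr (L : FOLDSSignature) where
  sort : L.Ob
  args : List ℕ
  deriving DecidableEq

/-- The variable `x_f`. -/
def SortExpr.argAt {L : FOLDSSignature} (E : SortExpr L) (f : Arr E.sort) : ℕ :=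
  E.args.getD ((L.fan E.sort).idxOf f) 0

/-- For a sort expression `K (x_f)` and an arrow `f` out of `K`, the sort expression
`K_f (x_{pf})` to which the variable `x_f` has to belong. -/
def SortExpr.dep {L : FOLDSSignature} (E : SortExpr L) (f : Arr E.sort) : SortExpr L :=
  ⟨f.1, (L.fan f.1).map fun p => E.argAt (f.comp p)⟩

/-- Contexts `x₁ : K₁, …, xₙ : Kₙ`, with the last variable at the head. -/
abbrev Ctx (L : FOLDSSignature) : Type := List (ℕ × SortExpr L)

/-- `Γ ⊢ K Sort`: every variable `x_f` is declared in `Γ` with the sort `K_f (x_{pf})`. -/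
def SortExpr.WF {L : FOLDSSignature} (Γ : Ctx L) (E : SortExpr L) : Prop :=
  E.args.length = (L.fan E.sort).length ∧
    ∀ f ∈ L.fan E.sort, (E.argAt f, E.dep f) ∈ Γ

instance {L : FOLDSSignature} (Γ : Ctx L) (E : SortExpr L) : Decidable (E.WF Γ) :=
  inferInstanceAs (Decidable (_ ∧ _))

/-- Raw formulas, with variables named by natural numbers. -/
inductive Formula (L : FOLDSSignature) : Type
  | bot
  | top
  | and (φ ψ : Formula L)
  | or (φ ψ : Formula L)
  | imp (φ ψ : Formula L)
  | all (x : ℕ) (E : SortExpr L) (φ : Formula L)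
  | ex (x : ℕ) (E : SortExpr L) (φ : Formula L)

/-- `Γ ⊢ φ formula`. -/
def Formula.WF {L : FOLDSSignature} : Ctx L → Formula L → Prop
  | _, bot => True
  | _, top => True
  | Γ, and φ ψ => φ.WF Γ ∧ ψ.WF Γ
  | Γ, or φ ψ => φ.WF Γ ∧ ψ.WF Γ
  | Γ, imp φ ψ => φ.WF Γ ∧ ψ.WF Γ
  | Γ, all x E φ => (x ∉ Γ.map Prod.fst ∧ E.WF Γ) ∧ φ.WF ((x, E) :: Γ)
  | Γ, ex x E φ => (x ∉ Γ.map Prod.fst ∧ E.WF Γ) ∧ φ.WF ((x, E) :: Γ)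

/-- Sentences: formulas in the empty context. -/
def Sentence (L : FOLDSSignature) : Type := { φ : Formula L // φ.WF [] }

/-! # Homotopy semantics -/

/-- The interpretation of a sort `K (x_f)` as a type, for given interpretations `S` of the
non-logical sorts and `x` of the variables, by recursion on the level of `K`.  The first numerical
argument bounds this recursion; the number of objects is a sufficient bound. -/
def interpSort (L : HSignature) (i : ℕ) (S : L.Ob → PTm) :
    ℕ → (K : L.Ob) → (Arr K → PTm) → PTm
  | 0, _, _ => PTm.empty
  | n + 1, K, x =>
    match L.kind K with
    | .nonlogical => PTm.el i (L.hlevel K) (PTm.apps (S K) ((L.fan K).map x))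
    | .iso A s t =>
      PTm.id (interpSort L i S n A fun p => x ⟨p.1, s ≫ p.2⟩) (x ⟨A, s⟩) (x ⟨A, t⟩)
    | .rho A E s t r =>
      PTm.id
        (PTm.id (interpSort L i S n A fun p => x ⟨p.1, r ≫ s ≫ p.2⟩)
          (x ⟨A, r ≫ s⟩) (x ⟨A, r ≫ t⟩))
        (x ⟨E, r⟩) (PTm.refl (x ⟨A, r ≫ s⟩))
    | .tau A B E f _ _ e f₁ f₂ =>
      PTm.id (interpSort L i S n A fun p => x ⟨p.1, f₂ ≫ p.2⟩) (x ⟨A, f₂⟩)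
        (PTm.transport
          (fun z => interpSort L i S n A fun p => if p = ⟨B, f⟩ then z else x ⟨p.1, f₁ ≫ p.2⟩)
          (x ⟨B, f₁ ≫ f⟩) (x ⟨B, f₂ ≫ f⟩) (x ⟨E, e⟩) (x ⟨A, f₁⟩))

/-- The iterated `Π`-type over the arrows `fs` out of `K`, with values in the types of h-level
`h(K)`; `x` interprets the arrows that precede `fs`. -/
def sortTypeAux (L : HSignature) (i : ℕ) (S : L.Ob → PTm) (K : L.Ob) :
    List (Arr K) → (Arr K → PTm) → PTm
  | [], _ => PTm.typesOfHLevel i (L.hlevel K)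
  | f :: fs, x =>
    PTm.pi (interpSort L i S L.objs.length f.1 fun p => x (f.comp p)) fun y =>
      sortTypeAux L i S K fs (Function.update x f y)

/-- The type `T_K` of interpretations of the non-logical sort `K` in `Uᵢ`. -/
def sortType (L : HSignature) (i : ℕ) (S : L.Ob → PTm) (K : L.Ob) : PTm :=
  sortTypeAux L i S K (L.fan K) fun _ => PTm.unit

/-- The non-logical sorts, in increasing order. -/
def nonlogicalSorts (L : HSignature) : List L.Ob :=
  L.objs.filter fun K => match L.kind K with
    | .nonlogical => true
    | _ => false

/-- The iterated `Σ`-type `Σ (K₁ : T_{K₁}) … (Kₙ : T_{Kₙ}), P` over interpretations of the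
non-logical sorts `Ks`; `S` interprets the preceding sorts. -/
def sigStrucAux (L : HSignature) (i : ℕ) (P : (L.Ob → PTm) → PTm) :
    List L.Ob → (L.Ob → PTm) → PTm
  | [], S => P S
  | K :: Ks, S => PTm.sig (sortType L i S K) fun X =>
      sigStrucAux L i P Ks (Function.update S K X)

/-- `Σ (M : HStruc L), P M`, for homotopy `L`-structures in `Uᵢ`. -/
def sigStruc (L : HSignature) (i : ℕ) (P : (L.Ob → PTm) → PTm) : PTm :=
  sigStrucAux L i P (nonlogicalSorts L) fun _ => PTm.unit

/-- The interpretation of a formula in the structure `S` under the assignment `v`. -/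
def interp (L : HSignature) (i : ℕ) (S : L.Ob → PTm) :
    (ℕ → PTm) → Formula L.toFOLDSSignature → PTm
  | _, .bot => PTm.empty
  | _, .top => PTm.unit
  | v, .and φ ψ => PTm.prod (interp L i S v φ) (interp L i S v ψ)
  | v, .or φ ψ => PTm.trunc (PTm.sum (interp L i S v φ) (interp L i S v ψ))
  | v, .imp φ ψ => PTm.arrow (interp L i S v φ) (interp L i S v ψ)
  | v, .all x E φ =>
    PTm.pi (interpSort L i S L.objs.length E.sort fun f => v (E.argAt f)) fun z =>
      interp L i S (Function.update v x z) φ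
  | v, .ex x E φ =>
    PTm.trunc (PTm.sig (interpSort L i S L.objs.length E.sort fun f => v (E.argAt f)) fun z =>
      interp L i S (Function.update v x z) φ)

/-- The product of the interpretations of finitely many sentences. -/
def interpAll (L : HSignature) (i : ℕ) (S : L.Ob → PTm) :
    List (Sentence L.toFOLDSSignature) → PTm
  | [] => PTm.unit
  | [φ] => interp L i S (fun _ => PTm.unit) φ.1
  | φ :: φs => PTm.prod (interp L i S (fun _ => PTm.unit) φ.1) (interpAll L i S φs)

/-- The type of models in `Uᵢ` of a finite theory. -/
def Mod (L : HSignature) (i : ℕ) (T : List (Sentence L.toFOLDSSignature)) : PTm :=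
  sigStruc L i fun S => interpAll L i S T

/-! # The signature and the theory of strict categories -/

/-- Objects `O`, arrows `A`, identities `I`, composition `∘` and equality of arrows `=_A`. -/
inductive CatSort : Type
  | O
  | A
  | I
  | comp
  | eqA
  deriving DecidableEq

/-- The arrows of the signature of categories. -/
inductive CatHom : CatSort → CatSort → Type
  | id (K) : CatHom K K
  | d : CatHom .A .O
  | c : CatHom .A .O
  | i : CatHom .I .A
  /-- `d i = c i` -/
  | di : CatHom .I .O
  | t₀ : CatHom .comp .A
  | t₁ : CatHom .comp .A
  | t₂ : CatHom .comp .A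
  /-- `d t₀ = d t₂` -/
  | dt₀ : CatHom .comp .O
  /-- `c t₀ = d t₁` -/
  | ct₀ : CatHom .comp .O
  /-- `c t₁ = c t₂` -/
  | ct₁ : CatHom .comp .O
  | s : CatHom .eqA .A
  | t : CatHom .eqA .A
  /-- `d s = d t` -/
  | ds : CatHom .eqA .O
  /-- `c s = c t` -/
  | cs : CatHom .eqA .O
  deriving DecidableEq

namespace CatHom

/-- Composition, in diagrammatic order. -/
def trans : {K K' K'' : CatSort} → CatHom K K' → CatHom K' K'' → CatHom K K''
  | _, _, _, id _, g => g
  | _, _, _, d, id _ => d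
  | _, _, _, c, id _ => c
  | _, _, _, di, id _ => di
  | _, _, _, dt₀, id _ => dt₀
  | _, _, _, ct₀, id _ => ct₀
  | _, _, _, ct₁, id _ => ct₁
  | _, _, _, ds, id _ => ds
  | _, _, _, cs, id _ => cs
  | _, _, _, i, id _ => i
  | _, _, _, i, d => di
  | _, _, _, i, c => di
  | _, _, _, t₀, id _ => t₀
  | _, _, _, t₀, d => dt₀
  | _, _, _, t₀, c => ct₀
  | _, _, _, t₁, id _ => t₁
  | _, _, _, t₁, d => ct₀
  | _, _, _, t₁, c => ct₁
  | _, _, _, t₂, id _ => t₂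
  | _, _, _, t₂, d => dt₀
  | _, _, _, t₂, c => ct₁
  | _, _, _, s, id _ => s
  | _, _, _, s, d => ds
  | _, _, _, s, c => cs
  | _, _, _, t, id _ => t
  | _, _, _, t, d => ds
  | _, _, _, t, c => cs

end CatHom

instance : Category.{0} CatSort where
  Hom := CatHom
  id := CatHom.id
  comp := CatHom.trans
  id_comp := by intro X Y f; cases f <;> rfl
  comp_id := by intro X Y f; cases f <;> rfl
  assoc := by intro W X Y Z f g k; cases f <;> cases g <;> cases k <;> rfl

instance (K K' : CatSort) : DecidableEq (K ⟶ K') :=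
  inferInstanceAs (DecidableEq (CatHom K K'))

instance (K : CatSort) : DecidableEq (Arr K) :=
  inferInstanceAs (DecidableEq (Σ K', CatHom K K'))

/-- The non-identity arrows of the signature of categories, in increasing order. -/
def catFan : (K : CatSort) → List (Arr K)
  | .O => []
  | .A => [⟨.O, CatHom.d⟩, ⟨.O, CatHom.c⟩]
  | .I => [⟨.O, CatHom.di⟩, ⟨.A, CatHom.i⟩]
  | .comp => [⟨.O, CatHom.dt₀⟩, ⟨.O, CatHom.ct₀⟩, ⟨.O, CatHom.ct₁⟩,
      ⟨.A, CatHom.t₀⟩, ⟨.A, CatHom.t₁⟩, ⟨.A, CatHom.t₂⟩]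
  | .eqA => [⟨.O, CatHom.ds⟩, ⟨.O, CatHom.cs⟩, ⟨.A, CatHom.s⟩, ⟨.A, CatHom.t⟩]

theorem CatHom.eq_id {K : CatSort} (f : CatHom K K) : f = CatHom.id K := by
  cases f; rfl

theorem mem_catFan (K : CatSort) (f : Arr K) : f ∈ catFan K ↔ ¬ f.IsId := by
  have e : f.IsId ↔ f = ⟨K, CatHom.id K⟩ := Iff.rfl
  rw [e]
  rcases f with ⟨K', f⟩
  change CatHom K K' at f
  cases f
  case id => cases K <;> simp [catFan]
  all_goals simp [catFan]

/-- The FOLDS signature of categories. -/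
def Lcat : FOLDSSignature where
  Ob := CatSort
  objs := [.O, .A, .I, .comp, .eqA]
  fan := catFan
  endo _ f := CatHom.eq_id f
  skeletal := by
    rintro K K' ⟨e⟩
    have f : CatHom K K' := e.hom
    have g : CatHom K' K := e.inv
    cases f <;> first | rfl | cases g
  mem_objs := by intro K; cases K <;> decide
  nodup_objs := by decide
  mem_fan := mem_catFan
  nodup_fan := by intro K; cases K <;> decide
  order_objs := by intro K; cases K <;> decide
  order_fan := by intro K; cases K <;> decide

/-- The logical sorts: `=_A` is the isomorphism sort of `A`. -/
def catKind : (K : CatSort) → SortKind K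
  | .eqA => .iso CatSort.A CatHom.s CatHom.t
  | .O => .nonlogical
  | .A => .nonlogical
  | .I => .nonlogical
  | .comp => .nonlogical

/-- The h-levels of the signature of strict categories. -/
def strcatLevel : CatSort → WithTop ℕ
  | .O => some 2
  | .A => some 2
  | .I => some 1
  | .comp => some 1
  | .eqA => some 1

theorem isTop_eqA (f : Arr CatSort.eqA) :
    f.IsTop ↔ f = ⟨CatSort.A, CatHom.s⟩ ∨ f = ⟨CatSort.A, CatHom.t⟩ := by
  constructor
  · rintro ⟨h₁, h₂⟩
    rcases f with ⟨K', f⟩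
    change CatHom .eqA K' at f
    cases f
    case id => exact absurd rfl h₁
    case s => exact Or.inl rfl
    case t => exact Or.inr rfl
    case ds =>
      rcases h₂ ⟨.A, CatHom.s⟩ ⟨.O, CatHom.d⟩ rfl with h | h <;> cases h
    case cs =>
      rcases h₂ ⟨.A, CatHom.s⟩ ⟨.O, CatHom.c⟩ rfl with h | h <;> cases h
  · rintro (rfl | rfl)
    all_goals
      refine ⟨(by intro h; cases h), ?_⟩
      rintro ⟨K', k⟩ ⟨K'', p⟩ h
      change CatHom .eqA K' at k
      change CatHom K' K'' at p
      cases k <;> cases p <;> first | exact Or.inl rfl | exact Or.inr rfl | cases h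

/-- The h-signature of strict categories: objects and arrows have h-level `2`, and identities,
composition and equality of arrows have h-level `1`. -/
def Lstrcat : HSignature where
  toFOLDSSignature := Lcat
  kind := catKind
  hlevel := strcatLevel
  iso_cond := by
    intro K K' f g e
    cases K <;> cases e
    refine ⟨?_, ?_, ?_, isTop_eqA, ?_, rfl⟩
    · exact le_rfl
    · intro h; cases h
    · intro p
      change CatHom .eqA .A at p
      cases p
      · exact Or.inl rfl
      · exact Or.inr rfl
    · rintro ⟨K', f⟩ hf
      change CatHom .A K' at f
      cases f
      · exact absurd rfl hf
      · rfl
      · rfl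
  rho_cond := by intro K; cases K <;> intro _ _ _ _ _ e <;> cases e
  tau_cond := by intro K; cases K <;> intro _ _ _ _ _ _ _ _ _ e <;> cases e
  iso_unique := by
    intro K K'
    cases K <;> cases K' <;> intro _ _ _ _ _ e e' <;> first | rfl | cases e; done | cases e'
  rho_unique := by intro K K'; cases K <;> intro _ _ _ _ _ _ e <;> cases e
  tau_unique := by intro K K'; cases K <;> intro _ _ _ _ _ _ _ _ _ _ _ _ e <;> cases e
  hlevel_zero := by intro K; cases K <;> intro e <;> cases e

namespace Lstrcat

/-- The sort `O`. -/
def O : SortExpr Lcat := ⟨CatSort.O, []⟩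

/-- The sort `A (x, y)` of arrows from `x` to `y`. -/
def A (x y : ℕ) : SortExpr Lcat := ⟨CatSort.A, [x, y]⟩

/-- The sort `I (f)`, for `f : A (x, x)`. -/
def I (x f : ℕ) : SortExpr Lcat := ⟨CatSort.I, [x, f]⟩

/-- The sort `∘ (f, g, k)`, for `f : A (x, y)`, `g : A (y, z)` and `k : A (x, z)`. -/
def C (x y z f g k : ℕ) : SortExpr Lcat := ⟨CatSort.comp, [x, y, z, f, g, k]⟩

/-- The sort `f =_A g`, for `f g : A (x, y)`. -/
def E (x y f g : ℕ) : SortExpr Lcat := ⟨CatSort.eqA, [x, y, f, g]⟩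

/-- Iterated universal quantification. -/
def alls (Γ : List (ℕ × SortExpr Lcat)) (φ : Formula Lcat) : Formula Lcat :=
  Γ.foldr (fun p ψ => .all p.1 p.2 ψ) φ

/-- Existence of identities. -/
def T₁ : Formula Lcat :=
  let x := 0; let i := 1; let σ := 2
  alls [(x, O)] <| .ex i (A x x) <| .ex σ (I x i) .top

/-- Existence of composites. -/
def T₂ : Formula Lcat :=
  let x := 0; let y := 1; let z := 2; let f := 3; let g := 4; let k := 5; let τ := 6
  alls [(x, O), (y, O), (z, O), (f, A x y), (g, A y z)] <|
    .ex k (A x z) <| .ex τ (C x y z f g k) .top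

/-- Uniqueness of composites. -/
def T₃ : Formula Lcat :=
  let x := 0; let y := 1; let z := 2; let f := 3; let g := 4; let k := 5; let k' := 6
  let τ₁ := 7; let τ₂ := 8; let ε := 9
  alls [(x, O), (y, O), (z, O), (f, A x y), (g, A y z), (k, A x z), (k', A x z),
      (τ₁, C x y z f g k), (τ₂, C x y z f g k')] <|
    .ex ε (E x z k k') .top

/-- Associativity. -/
def T₄ : Formula Lcat :=
  let x := 0; let y := 1; let z := 2; let w := 3; let f := 4; let g := 5; let h := 6
  let i := 7; let j := 8; let k := 9; let τ₁ := 10; let τ₂ := 11; let τ₃ := 12; let τ₄ := 13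
  alls [(x, O), (y, O), (z, O), (w, O), (f, A x y), (g, A y z), (h, A z w),
      (i, A x z), (j, A x w), (k, A y w),
      (τ₁, C x y z f g i), (τ₂, C x z w i h j), (τ₃, C y z w g h k)] <|
    .ex τ₄ (C x y w f k j) .top

/-- Uniqueness of identities. -/
def T₅ : Formula Lcat :=
  let x := 0; let i := 1; let j := 2; let σ₁ := 3; let σ₂ := 4; let ε := 5
  alls [(x, O), (i, A x x), (j, A x x), (σ₁, I x i), (σ₂, I x j)] <| .ex ε (E x x i j) .top

/-- Right unit. -/
def T₆ : Formula Lcat :=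
  let x := 0; let y := 1; let i := 2; let g := 3; let σ := 4; let τ := 5
  alls [(x, O), (y, O), (i, A x x), (g, A x y), (σ, I x i)] <| .ex τ (C x x y i g g) .top

/-- Left unit. -/
def T₇ : Formula Lcat :=
  let x := 0; let y := 1; let i := 2; let f := 3; let σ := 4; let τ := 5
  alls [(x, O), (y, O), (i, A y y), (f, A x y), (σ, I y i)] <| .ex τ (C x y y f i f) .top

end Lstrcat

instance decidableWF {L : FOLDSSignature} : (Γ : Ctx L) → (φ : Formula L) → Decidable (φ.WF Γ)
  | _, .bot => isTrue trivial
  | _, .top => isTrue trivial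
  | Γ, .and φ ψ => @instDecidableAnd _ _ (decidableWF Γ φ) (decidableWF Γ ψ)
  | Γ, .or φ ψ => @instDecidableAnd _ _ (decidableWF Γ φ) (decidableWF Γ ψ)
  | Γ, .imp φ ψ => @instDecidableAnd _ _ (decidableWF Γ φ) (decidableWF Γ ψ)
  | Γ, .all x E φ => @instDecidableAnd _ _ inferInstance (decidableWF ((x, E) :: Γ) φ)
  | Γ, .ex x E φ => @instDecidableAnd _ _ inferInstance (decidableWF ((x, E) :: Γ) φ)

open Lstrcat in
/-- The theory of strict categories, which has the axioms of the theory of categories. -/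
def Tstrcat : List (Sentence Lcat) :=
  [⟨T₁, by decide⟩, ⟨T₂, by decide⟩, ⟨T₃, by decide⟩, ⟨T₄, by decide⟩, ⟨T₅, by decide⟩,
    ⟨T₆, by decide⟩, ⟨T₇, by decide⟩]

end FOLiso

namespace HoTT.PTm

/-! # Strict categories in homotopy type theory -/

/-- Sets in `Uᵢ`. -/
def setU (i : ℕ) : PTm := typesOfHLevel i (some 2)

/-- The type of precategories in `Uᵢ`: a type `C` of objects, sets `Hom a b`, identities `e`,
composition `c` (with `c x y z f g` the composite of `f : Hom x y` and `g : Hom y z`),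
associativity and the unit laws. -/
def PreCat (i : ℕ) : PTm :=
  sig (univ i) fun C =>
  sig (arrow C (arrow C (setU i))) fun H =>
  let Hom : PTm → PTm → PTm := fun a b => el i (some 2) (apps H [a, b])
  sig (pi C fun a => Hom a a) fun e =>
  sig (pi C fun x => pi C fun y => pi C fun z =>
    arrow (Hom x y) (arrow (Hom y z) (Hom x z))) fun c =>
  prod
    (pi C fun x => pi C fun y => pi C fun z => pi C fun w =>
      pi (Hom x y) fun f => pi (Hom y z) fun g => pi (Hom z w) fun k =>
        id (Hom x w)
          (apps c [x, z, w, apps c [x, y, z, f, g], k])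
          (apps c [x, y, w, f, apps c [y, z, w, g, k]]))
    (pi C fun x => pi C fun y => pi (Hom x y) fun f =>
      prod (id (Hom x y) (apps c [x, x, y, app e x, f]) f)
        (id (Hom x y) (apps c [x, y, y, f, app e y]) f))

/-- The type of strict categories in `Uᵢ`: precategories whose type of objects is a set. -/
def StrCat (i : ℕ) : PTm :=
  sig (PreCat i) fun P => isOfHLevel 2 (fst (univ i) P)

end HoTT.PTm

namespace HoTT

namespace Tm

/-! # The substitution calculus -/

-- The mathematics. A strict category yields a model on the same objects and arrows through graph
-- relations: `I(f)` is the path type `1_x = f`, and `∘(f, g, h)` is the path type from the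
-- composite of `f` and `g` to `h`. These are mere propositions because hom-types are sets.
-- Conversely, axioms 1 and 2 give identities and composites only under a truncation, but by axioms
-- 5 and 3 the types `Σ i, I(i)` and `Σ h, ∘(f, g, h)` have at most one element (`idnUnique`,
-- `cmpUnique`). The truncation can therefore be eliminated, and axioms 4, 6 and 7 become the laws
-- of a category (`laws`).
--
-- Starting from a category, the round trip gives back the operations by computation, and the laws
-- agree because they are paths in sets (`lawsProp`). Starting from a model, a relation that holds
-- exactly at one element is the graph relation of that element, by propositional extensionality and
-- function extensionality (`singleton`, `idnRelEq`, `cmpRelEq`). Since the axioms are mere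
-- propositions (`axProp`), equality of the relations is equality of the models (`modelPath`).
--
-- The formalization. A derivation in the formal system is required, so the argument is written as
-- sparsely annotated terms. An elaborating type checker completes and checks them; it is proved
-- sound for `HasType` (`Checker.run_sound`) and evaluated by the kernel. Soundness rests on the
-- substitution lemma `HasType.act`, which treats substitution and raising of universe levels
-- together. Proved lemmas are kept as variables of a context and are discharged by substituting
-- closed proofs (`Inhabited`). The checker is run only for `U₀`; `HasType.lift` carries the
-- derivation to every universe.

theorem upRen_comp (r s : ℕ → ℕ) : upRen (r ∘ s) = upRen r ∘ upRen s := by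
  funext n; cases n <;> rfl

theorem upRen_id : upRen (fun n => n) = fun n => n := by
  funext n; cases n <;> rfl

theorem up_var : up var = var := by
  funext n; cases n <;> rfl

theorem rename_rename (t : Tm) (r s : ℕ → ℕ) :
    rename r (rename s t) = rename (r ∘ s) t := by
  induction t generalizing r s <;> simp_all [rename, upRen_comp]

theorem rename_id (t : Tm) : rename (fun n => n) t = t := by
  induction t <;> simp_all [rename, upRen_id]

theorem up_comp_upRen (s : ℕ → Tm) (r : ℕ → ℕ) : up (s ∘ r) = up s ∘ upRen r := by
  funext n; cases n <;> rfl

theorem subst_rename (t : Tm) (s : ℕ → Tm) (r : ℕ → ℕ) :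
    subst s (rename r t) = subst (s ∘ r) t := by
  induction t generalizing r s <;> simp_all [rename, subst, up_comp_upRen]

theorem up_rename_comp (r : ℕ → ℕ) (s : ℕ → Tm) :
    up (rename r ∘ s) = rename (upRen r) ∘ up s := by
  funext n
  cases n with
  | zero => rfl
  | succ n =>
    simp only [up, shift, Function.comp, rename_rename]
    rfl

theorem rename_subst (t : Tm) (r : ℕ → ℕ) (s : ℕ → Tm) :
    rename r (subst s t) = subst (rename r ∘ s) t := by
  induction t generalizing r s <;> simp_all [rename, subst, up_rename_comp]

theorem up_subst_comp (r s : ℕ → Tm) : up (subst r ∘ s) = subst (up r) ∘ up s := by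
  funext n
  cases n with
  | zero => rfl
  | succ n =>
    simp only [up, shift, Function.comp, rename_subst, subst_rename]
    rfl

theorem subst_subst (t : Tm) (r s : ℕ → Tm) :
    subst r (subst s t) = subst (subst r ∘ s) t := by
  induction t generalizing r s <;> simp_all [subst, up_subst_comp]

theorem subst_var (t : Tm) : subst var t = t := by
  induction t <;> simp_all [subst, up_var]

theorem up_var_comp (r : ℕ → ℕ) : up (var ∘ r) = var ∘ upRen r := by
  funext n; cases n <;> rfl

theorem rename_eq_subst (t : Tm) (r : ℕ → ℕ) : rename r t = subst (var ∘ r) t := by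
  induction t generalizing r <;> simp_all [rename, subst, up_var_comp]

theorem shift_eq_subst (k : ℕ) (t : Tm) : shift k t = subst (fun n => var (n + k)) t :=
  rename_eq_subst t _

theorem shift_zero (t : Tm) : shift 0 t = t := rename_id t

theorem shift_shift (j k : ℕ) (t : Tm) : shift j (shift k t) = shift (k + j) t := by
  simp only [shift, rename_rename]
  congr 1; funext n; simp [Function.comp, Nat.add_assoc]

theorem shift_one_inst (t a : Tm) : (shift 1 t).inst a = t := by
  rw [inst, shift, subst_rename]
  exact subst_var t

/-! # Raising universe levels -/

/-- Raise all universe levels by `k`. -/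
def lift (k : ℕ) : Tm → Tm
  | var n => var n
  -- The summands are in this order so that `k + (i + 1)` is the successor of `k + i` and `k + 0` is
  -- `k` by definition: the rules for universes then apply without rewriting.
  | univ i => univ (k + i)
  | pi A B => pi (lift k A) (lift k B)
  | lam A b => lam (lift k A) (lift k b)
  | app f a => app (lift k f) (lift k a)
  | sig A B => sig (lift k A) (lift k B)
  | pair a b => pair (lift k a) (lift k b)
  | sigInd C g p => sigInd (lift k C) (lift k g) (lift k p)
  | unit => unit
  | star => star
  | unitInd C c a => unitInd (lift k C) (lift k c) (lift k a)
  | empty => empty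
  | emptyInd C a => emptyInd (lift k C) (lift k a)
  | sum A B => sum (lift k A) (lift k B)
  | inl a => inl (lift k a)
  | inr b => inr (lift k b)
  | sumInd C c d e => sumInd (lift k C) (lift k c) (lift k d) (lift k e)
  | id A a b => id (lift k A) (lift k a) (lift k b)
  | refl a => refl (lift k a)
  | idInd C c a b p => idInd (lift k C) (lift k c) (lift k a) (lift k b) (lift k p)
  | trunc A => trunc (lift k A)
  | truncIn a => truncIn (lift k a)
  | truncPath a b => truncPath (lift k a) (lift k b)
  | truncRec B w f t => truncRec (lift k B) (lift k w) (lift k f) (lift k t)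
  | funext A B f g => funext (lift k A) (lift k B) (lift k f) (lift k g)
  | univalence i A B => univalence (k + i) (lift k A) (lift k B)

theorem lift_zero (t : Tm) : lift 0 t = t := by
  induction t <;> simp_all [lift]

theorem lift_rename (k : ℕ) (t : Tm) (r : ℕ → ℕ) :
    lift k (rename r t) = rename r (lift k t) := by
  induction t generalizing r <;> simp_all [lift, rename]

theorem lift_shift (k j : ℕ) (t : Tm) : lift k (shift j t) = shift j (lift k t) :=
  lift_rename k t _

theorem lift_comp_up (k : ℕ) (s : ℕ → Tm) : lift k ∘ up s = up (lift k ∘ s) := by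
  funext n
  cases n with
  | zero => rfl
  | succ n => exact lift_shift k 1 (s n)

theorem lift_subst (k : ℕ) (t : Tm) (s : ℕ → Tm) :
    lift k (subst s t) = subst (lift k ∘ s) (lift k t) := by
  induction t generalizing s <;> simp_all [lift, subst, ← lift_comp_up]

/-! # Raising levels and substituting simultaneously -/

/-- Raise the universe levels by `k` and then substitute `s`. -/
def act (k : ℕ) (s : ℕ → Tm) (t : Tm) : Tm := subst s (lift k t)

theorem act_zero (s : ℕ → Tm) (t : Tm) : act 0 s t = subst s t := by
  rw [act, lift_zero]

theorem act_var' (k : ℕ) (t : Tm) : act k var t = lift k t := subst_var _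

/-- The composite of the substitution `s` with the action of `k` and `r`. -/
theorem act_subst (k : ℕ) (r s : ℕ → Tm) (t : Tm) :
    act k r (subst s t) = subst (act k r ∘ s) (lift k t) := by
  simp only [act, lift_subst, subst_subst]
  rfl

theorem subst_act (k : ℕ) (r s : ℕ → Tm) (t : Tm) :
    subst r (act k s t) = subst (subst r ∘ s) (lift k t) := by
  simp only [act, subst_subst]

theorem act_shift (k j : ℕ) (s : ℕ → Tm) (t : Tm) :
    act k s (shift j t) = act k (fun n => s (n + j)) t := by
  rw [act, lift_shift, shift, subst_rename]; rfl

theorem up_shift_act (k : ℕ) (s : ℕ → Tm) (t : Tm) :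
    act k (up s) (shift 1 t) = shift 1 (act k s t) := by
  rw [act_shift, act, act, shift, rename_subst]; rfl

theorem act_inst (k : ℕ) (s : ℕ → Tm) (B a : Tm) :
    act k s (inst B a) = inst (act k (up s) B) (act k s a) := by
  rw [inst, inst, act_subst, subst_act]
  congr 1; funext n
  cases n with
  | zero => rfl
  | succ n => exact (shift_one_inst _ _).symm

theorem subst_scons_shift_one (a : Tm) (s : ℕ → Tm) (t : Tm) :
    subst (scons a s) (shift 1 t) = subst s t := by
  rw [shift, subst_rename]; rfl

theorem act_inst₂ (k : ℕ) (s : ℕ → Tm) (B a b : Tm) :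
    act k s (inst₂ B a b) = inst₂ (act k (up (up s)) B) (act k s a) (act k s b) := by
  rw [inst₂, inst₂, act_subst, subst_act]
  congr 1; funext n
  rcases n with _ | _ | n
  · rfl
  · rfl
  · simp [up, scons, subst_scons_shift_one, subst_var, act, lift, subst]

theorem act_inst₃ (k : ℕ) (s : ℕ → Tm) (B a b c : Tm) :
    act k s (inst₃ B a b c) =
      inst₃ (act k (up (up (up s))) B) (act k s a) (act k s b) (act k s c) := by
  rw [inst₃, inst₃, act_subst, subst_act]
  congr 1; funext n
  rcases n with _ | _ | _ | n
  · rfl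
  · rfl
  · rfl
  · simp [up, scons, subst_scons_shift_one, subst_var, act, lift, subst]

/-- Two ways to substitute in the motive `C` of an eliminator along a constructor `u` with `m`
arguments. -/
theorem act_up_subst (k m : ℕ) (s s' : ℕ → Tm) (u u' : Tm) (C : Tm)
    (hs : ∀ n, s' (n + m) = shift m (s n)) (hu : act k s' u = u') :
    act k s' (subst (scons u fun n => var (n + m)) C) =
      subst (scons u' fun n => var (n + m)) (act k (up s) C) := by
  rw [act_subst, subst_act]
  congr 1; funext n
  cases n with
  | zero => exact hu
  | succ n =>
    simp only [Function.comp, scons, up, act, lift, subst, hs, subst_subst,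
      shift_eq_subst]
    rfl

end Tm

open Tm

/-- Conversion is stable under raising levels and under substitution. -/
theorem Conv.act {a b : Tm} (h : Conv a b) (k : ℕ) (s : ℕ → Tm) :
    Conv (a.act k s) (b.act k s) := by
  induction h generalizing s with
  | refl => exact .refl _
  | symm _ ih => exact .symm (ih s)
  | trans _ _ ih₁ ih₂ => exact .trans (ih₁ s) (ih₂ s)
  | beta A b a => rw [act_inst]; exact .beta _ _ _
  | eta A f =>
    have e : Tm.act k s (.lam A (.app (f.shift 1) (.var 0))) =
        .lam (A.act k s) (.app ((f.act k s).shift 1) (.var 0)) := by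
      rw [← up_shift_act]; rfl
    rw [e]; exact .eta _ _
  | sigBeta => rw [act_inst₂]; exact .sigBeta _ _ _ _
  | unitBeta => exact .unitBeta _ _
  | inlBeta => rw [act_inst]; exact .inlBeta _ _ _ _
  | inrBeta => rw [act_inst]; exact .inrBeta _ _ _ _
  | idBeta => rw [act_inst]; exact .idBeta _ _ _ _ _
  | truncBeta => exact .truncBeta _ _ _ _
  | pi _ _ ih₁ ih₂ => exact .pi (ih₁ _) (ih₂ _)
  | lam _ _ ih₁ ih₂ => exact .lam (ih₁ _) (ih₂ _)
  | app _ _ ih₁ ih₂ => exact .app (ih₁ _) (ih₂ _)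
  | sig _ _ ih₁ ih₂ => exact .sig (ih₁ _) (ih₂ _)
  | pair _ _ ih₁ ih₂ => exact .pair (ih₁ _) (ih₂ _)
  | sigInd _ _ _ ih₁ ih₂ ih₃ => exact .sigInd (ih₁ _) (ih₂ _) (ih₃ _)
  | unitInd _ _ _ ih₁ ih₂ ih₃ => exact .unitInd (ih₁ _) (ih₂ _) (ih₃ _)
  | emptyInd _ _ ih₁ ih₂ => exact .emptyInd (ih₁ _) (ih₂ _)
  | sum _ _ ih₁ ih₂ => exact .sum (ih₁ _) (ih₂ _)
  | inl _ ih₁ => exact .inl (ih₁ _)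
  | inr _ ih₁ => exact .inr (ih₁ _)
  | sumInd _ _ _ _ ih₁ ih₂ ih₃ ih₄ => exact .sumInd (ih₁ _) (ih₂ _) (ih₃ _) (ih₄ _)
  | id _ _ _ ih₁ ih₂ ih₃ => exact .id (ih₁ _) (ih₂ _) (ih₃ _)
  | reflCongr _ ih₁ => exact .reflCongr (ih₁ _)
  | idInd _ _ _ _ _ ih₁ ih₂ ih₃ ih₄ ih₅ =>
    exact .idInd (ih₁ _) (ih₂ _) (ih₃ _) (ih₄ _) (ih₅ _)
  | trunc _ ih₁ => exact .trunc (ih₁ _)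
  | truncIn _ ih₁ => exact .truncIn (ih₁ _)
  | truncPath _ _ ih₁ ih₂ => exact .truncPath (ih₁ _) (ih₂ _)
  | truncRec _ _ _ _ ih₁ ih₂ ih₃ ih₄ => exact .truncRec (ih₁ _) (ih₂ _) (ih₃ _) (ih₄ _)
  | funext _ _ _ _ ih₁ ih₂ ih₃ ih₄ => exact .funext (ih₁ _) (ih₂ _) (ih₃ _) (ih₄ _)
  | univalence _ _ ih₁ ih₂ => exact .univalence (ih₁ _) (ih₂ _)

end HoTT

-- Typing is stable under substitution and under raising of universe levels.

namespace HoTT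

open Tm

namespace Tm

theorem shift_var (k n : ℕ) : shift k (var n) = var (n + k) := rfl

theorem subst_up_shift (s : ℕ → Tm) (j : ℕ) (t : Tm) :
    subst (up s) (shift (j + 1) t) = shift 1 (subst s (shift j t)) := by
  rw [← shift_shift 1 j]
  generalize shift j t = u
  rw [shift, subst_rename, shift, rename_subst]; rfl

/-- The typing rules for truncation recursion, univalence and function extensionality mention types
built with named binders; this lemma and the next two move the action inside those types. -/
theorem act_isProp (k : ℕ) (s : ℕ → Tm) (B : Tm) :
    act k s (PTm.isProp (PTm.ofTm B) 0) = PTm.isProp (PTm.ofTm (act k s B)) 0 := by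
  simp [PTm.isProp, PTm.pi, PTm.id, PTm.ofTm, PTm.bvar, act, lift, subst, up,
    lift_shift, subst_up_shift, shift_shift, shift_zero, shift_var]

theorem act_univalence (k i : ℕ) (s : ℕ → Tm) (A B : Tm) :
    act k s (PTm.isEquiv
        (PTm.id (PTm.univ i) (PTm.ofTm A) (PTm.ofTm B))
        (PTm.equiv (PTm.ofTm A) (PTm.ofTm B))
        (PTm.idToEquiv i (PTm.ofTm A) (PTm.ofTm B)) 0) =
      PTm.isEquiv
        (PTm.id (PTm.univ (k + i)) (PTm.ofTm (act k s A)) (PTm.ofTm (act k s B)))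
        (PTm.equiv (PTm.ofTm (act k s A)) (PTm.ofTm (act k s B)))
        (PTm.idToEquiv (k + i) (PTm.ofTm (act k s A)) (PTm.ofTm (act k s B))) 0 := by
  simp [PTm.isEquiv, PTm.equiv, PTm.idToEquiv, PTm.idEquiv, PTm.pair, PTm.univ, PTm.prod,
    PTm.sig, PTm.arrow, PTm.pi, PTm.id, PTm.app, PTm.lam, PTm.refl, PTm.idInd, PTm.bvar,
    PTm.ofTm, act, lift, subst, up,
    lift_shift, subst_up_shift, shift_shift, shift_zero, shift_var]

theorem act_funext (k : ℕ) (s : ℕ → Tm) (A B f g : Tm) :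
    act k s (PTm.isEquiv
        (PTm.id (PTm.ofTm (.pi A B)) (PTm.ofTm f) (PTm.ofTm g))
        (PTm.pi (PTm.ofTm A) fun x =>
          PTm.id (PTm.ofFam B x) (PTm.app (PTm.ofTm f) x) (PTm.app (PTm.ofTm g) x))
        (PTm.happly (PTm.ofTm A) (PTm.ofFam B) (PTm.ofTm f) (PTm.ofTm g)) 0) =
      PTm.isEquiv
        (PTm.id (PTm.ofTm (.pi (act k s A) (act k (up s) B))) (PTm.ofTm (act k s f))
          (PTm.ofTm (act k s g)))
        (PTm.pi (PTm.ofTm (act k s A)) fun x =>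
          PTm.id (PTm.ofFam (act k (up s) B) x) (PTm.app (PTm.ofTm (act k s f)) x)
            (PTm.app (PTm.ofTm (act k s g)) x))
        (PTm.happly (PTm.ofTm (act k s A)) (PTm.ofFam (act k (up s) B))
          (PTm.ofTm (act k s f)) (PTm.ofTm (act k s g))) 0 := by
  have hF : ∀ (s' : ℕ → Tm) (m j : ℕ), (∀ n, s' (n + m) = shift m (s n)) → s' j = .var j →
      subst s' (lift k (subst (scons (.var j) fun n => .var (n + m)) B)) =
        subst (scons (.var j) fun n => .var (n + m)) (subst (up s) (lift k B)) :=
    fun s' m j hs hj => act_up_subst k m s s' _ _ B hs hj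
  have u : ∀ m, (∀ n, (up^[m]) s (n + m) = shift m (s n)) := fun m n => by
    induction m with
    | zero => exact (shift_zero _).symm
    | succ m ih =>
      rw [Function.iterate_succ_apply', ← shift_shift, ← ih]; rfl
  have v : ∀ m, 0 < m → (up^[m]) s 0 = .var 0 := fun m hm => by
    cases m with
    | zero => omega
    | succ m => rw [Function.iterate_succ_apply']; rfl
  simp only [PTm.isEquiv, PTm.happly, PTm.prod, PTm.ofFam,
    PTm.sig, PTm.arrow, PTm.pi, PTm.id, PTm.app, PTm.lam, PTm.refl, PTm.idInd, PTm.bvar,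
    PTm.ofTm, act, lift, subst, lift_shift, subst_up_shift, shift_shift, shift_zero,
    Nat.reduceAdd, Nat.reduceSub, Nat.zero_add]
  -- In the type of the constant, the family `B` is applied to the innermost variable, below 1, 2,
  -- 3, 4, 7 or 8 binders.
  have e₁ := hF _ 1 0 (u 1) (v 1 (by decide))
  have e₂ := hF _ 2 0 (u 2) (v 2 (by decide))
  have e₃ := hF _ 3 0 (u 3) (v 3 (by decide))
  have e₄ := hF _ 4 0 (u 4) (v 4 (by decide))
  have e₇ := hF _ 7 0 (u 7) (v 7 (by decide))
  have e₈ := hF _ 8 0 (u 8) (v 8 (by decide))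
  simp only [Function.iterate_succ_apply', Function.iterate_zero_apply] at e₁ e₂ e₃ e₄ e₇ e₈
  simp only [e₁, e₂, e₃, e₄, e₇, e₈]
  rfl

end Tm

/-- A notion of substitution that is stable under binders and well typed when the universe levels
of the source are raised by `k`. -/
structure Kit (k : ℕ) (K : List Tm → (ℕ → Tm) → List Tm → Prop) : Prop where
  var : ∀ {Δ s Γ n A}, K Δ s Γ → IsCtx Δ → Γ[n]? = some A →
    HasType Δ (s n) (act k s (A.shift (n + 1)))
  up : ∀ {Δ s Γ A i}, K Δ s Γ → HasType Δ (act k s A) (.univ i) →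
    K (act k s A :: Δ) (Tm.up s) (A :: Γ)

/-- The substitution lemma for a kit, with the same statement for all types in the context. -/
theorem HasType.act_aux {k K} (hK : Kit k K) {Γ t A} (h : HasType Γ t A) :
    (∀ Δ s, IsCtx Δ → K Δ s Γ → HasType Δ (act k s t) (act k s A)) ∧
    ∀ B Γ', (B :: Γ') <:+ Γ → ∃ i, ∀ Δ s, IsCtx Δ → K Δ s Γ' →
      HasType Δ (act k s B) (.univ i) := by
  -- The second conjunct is needed for the eliminators: their rules have premises in extended
  -- contexts but no premise saying that the added types are types. That fact is buried in the
  -- context derivation, so the induction has to carry the claim for every entry of the context.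
  refine HasType.rec
    (motive_1 := fun Γ _ => ∀ B Γ', (B :: Γ') <:+ Γ → ∃ i, ∀ Δ s, IsCtx Δ → K Δ s Γ' →
      HasType Δ (act k s B) (.univ i))
    (motive_2 := fun Γ t A _ =>
      (∀ Δ s, IsCtx Δ → K Δ s Γ → HasType Δ (act k s t) (act k s A)) ∧
      ∀ B Γ', (B :: Γ') <:+ Γ → ∃ i, ∀ Δ s, IsCtx Δ → K Δ s Γ' →
        HasType Δ (act k s B) (.univ i))
    ?nil ?cons ?var ?conv ?univ ?cumul ?pi ?lam ?app ?sig ?pair ?sigInd ?unit ?star ?unitInd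
    ?empty ?emptyInd ?sum ?inl ?inr ?sumInd ?id ?refl ?idInd ?trunc ?truncIn ?truncPath
    ?truncRec ?funext ?univalence h
  case nil => intro B Γ' h; simp at h
  case cons =>
    intro Γ A i _ ih B Γ' h
    rcases List.suffix_cons_iff.1 h with h | h
    · cases h
      exact ⟨_, ih.1⟩
    · exact ih.2 B Γ' h
  case var => intro Γ n A hΓ hn ih; exact ⟨fun Δ s hΔ hs => hK.var hs hΔ hn, ih⟩
  case conv =>
    intro Γ a A B i _ _ h ih₁ ih₂
    exact ⟨fun Δ s hΔ hs => .conv (ih₁.1 Δ s hΔ hs) (ih₂.1 Δ s hΔ hs) (h.act k s), ih₁.2⟩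
  case univ => intro Γ i _ ih; exact ⟨fun Δ s hΔ hs => .univ _ hΔ, ih⟩
  case cumul => intro Γ A i _ ih; exact ⟨fun Δ s hΔ hs => .cumul (ih.1 Δ s hΔ hs), ih.2⟩
  case pi =>
    intro Γ A B i _ _ ih₁ ih₂
    refine ⟨fun Δ s hΔ hs => ?_, ih₁.2⟩
    have h₁ := ih₁.1 Δ s hΔ hs
    exact .pi h₁ (ih₂.1 _ _ (.cons h₁) (hK.up hs h₁))
  case lam =>
    intro Γ A b B i _ _ ih₁ ih₂
    refine ⟨fun Δ s hΔ hs => ?_, ih₁.2⟩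
    have h₁ := ih₁.1 Δ s hΔ hs
    exact .lam h₁ (ih₂.1 _ _ (.cons h₁) (hK.up hs h₁))
  case app =>
    intro Γ f a A B _ _ ih₁ ih₂
    refine ⟨fun Δ s hΔ hs => ?_, ih₁.2⟩
    rw [act_inst]
    exact .app (ih₁.1 Δ s hΔ hs) (ih₂.1 Δ s hΔ hs)
  case sig =>
    intro Γ A B i _ _ ih₁ ih₂
    refine ⟨fun Δ s hΔ hs => ?_, ih₁.2⟩
    have h₁ := ih₁.1 Δ s hΔ hs
    exact .sig h₁ (ih₂.1 _ _ (.cons h₁) (hK.up hs h₁))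
  case pair =>
    intro Γ a b A B i _ _ _ _ ih₁ ih₂ ih₃ ih₄
    refine ⟨fun Δ s hΔ hs => ?_, ih₁.2⟩
    have h₁ := ih₁.1 Δ s hΔ hs
    have h₄ := ih₄.1 Δ s hΔ hs
    rw [act_inst] at h₄
    exact .pair h₁ (ih₂.1 _ _ (.cons h₁) (hK.up hs h₁)) (ih₃.1 Δ s hΔ hs) h₄
  case sigInd =>
    intro Γ A B C g p i _ _ _ ih₁ ih₂ ih₃
    refine ⟨fun Δ s hΔ hs => ?_, ih₃.2⟩
    obtain ⟨_, hS⟩ := ih₁.2 (.sig A B) Γ (List.suffix_refl _)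
    obtain ⟨_, hA⟩ := ih₂.2 A Γ (List.suffix_cons _ _)
    obtain ⟨_, hB⟩ := ih₂.2 B (A :: Γ) (List.suffix_refl _)
    have h₁ := hS Δ s hΔ hs
    have h₂ := hA Δ s hΔ hs
    have h₃ := hB _ _ (.cons h₂) (hK.up hs h₂)
    have h₄ := ih₂.1 _ _ (.cons h₃) (hK.up (hK.up hs h₂) h₃)
    rw [act_up_subst k 2 s (Tm.up (Tm.up s)) _ _ C
      (fun n => by simp [Tm.up, shift_shift]) rfl] at h₄
    rw [act_inst]
    exact .sigInd (ih₁.1 _ _ (.cons h₁) (hK.up hs h₁)) h₄ (ih₃.1 Δ s hΔ hs)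
  case unit => intro Γ i _ ih; exact ⟨fun Δ s hΔ hs => .unit (k + i) hΔ, ih⟩
  case star => intro Γ _ ih; exact ⟨fun Δ s hΔ hs => .star hΔ, ih⟩
  case unitInd =>
    intro Γ C c a i _ _ _ ih₁ ih₂ ih₃
    refine ⟨fun Δ s hΔ hs => ?_, ih₂.2⟩
    have h₁ : HasType Δ (Tm.act k s .unit) (.univ 0) := .unit 0 hΔ
    rw [act_inst]
    refine .unitInd (ih₁.1 _ _ (.cons h₁) (hK.up hs h₁)) ?_ (ih₃.1 Δ s hΔ hs)
    have h := ih₂.1 Δ s hΔ hs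
    rwa [act_inst] at h
  case empty => intro Γ i _ ih; exact ⟨fun Δ s hΔ hs => .empty (k + i) hΔ, ih⟩
  case emptyInd =>
    intro Γ C a i _ _ ih₁ ih₂
    refine ⟨fun Δ s hΔ hs => ?_, ih₂.2⟩
    have h₁ : HasType Δ (Tm.act k s .empty) (.univ 0) := .empty 0 hΔ
    rw [act_inst]
    exact .emptyInd (ih₁.1 _ _ (.cons h₁) (hK.up hs h₁)) (ih₂.1 Δ s hΔ hs)
  case sum =>
    intro Γ A B i _ _ ih₁ ih₂
    exact ⟨fun Δ s hΔ hs => .sum (ih₁.1 Δ s hΔ hs) (ih₂.1 Δ s hΔ hs), ih₁.2⟩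
  case inl =>
    intro Γ a A B i _ _ _ ih₁ ih₂ ih₃
    exact ⟨fun Δ s hΔ hs => .inl (ih₁.1 Δ s hΔ hs) (ih₂.1 Δ s hΔ hs) (ih₃.1 Δ s hΔ hs), ih₁.2⟩
  case inr =>
    intro Γ a A B i _ _ _ ih₁ ih₂ ih₃
    exact ⟨fun Δ s hΔ hs => .inr (ih₁.1 Δ s hΔ hs) (ih₂.1 Δ s hΔ hs) (ih₃.1 Δ s hΔ hs), ih₁.2⟩
  case sumInd =>
    intro Γ A B C c d e i _ _ _ _ ih₁ ih₂ ih₃ ih₄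
    refine ⟨fun Δ s hΔ hs => ?_, ih₄.2⟩
    obtain ⟨_, hS⟩ := ih₁.2 (.sum A B) Γ (List.suffix_refl _)
    obtain ⟨_, hA⟩ := ih₂.2 A Γ (List.suffix_refl _)
    obtain ⟨_, hB⟩ := ih₃.2 B Γ (List.suffix_refl _)
    have h₁ := hS Δ s hΔ hs
    have h₂ := hA Δ s hΔ hs
    have h₃ := hB Δ s hΔ hs
    rw [act_inst]
    have hc := ih₂.1 _ _ (.cons h₂) (hK.up hs h₂)
    have hd := ih₃.1 _ _ (.cons h₃) (hK.up hs h₃)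
    rw [act_up_subst k 1 s (Tm.up s) _ _ C (fun _ => rfl) rfl] at hc hd
    exact .sumInd (ih₁.1 _ _ (.cons h₁) (hK.up hs h₁)) hc hd (ih₄.1 Δ s hΔ hs)
  case id =>
    intro Γ A a b i _ _ _ ih₁ ih₂ ih₃
    exact ⟨fun Δ s hΔ hs => .id (ih₁.1 Δ s hΔ hs) (ih₂.1 Δ s hΔ hs) (ih₃.1 Δ s hΔ hs), ih₁.2⟩
  case refl =>
    intro Γ A a i _ _ ih₁ ih₂
    exact ⟨fun Δ s hΔ hs => .refl (ih₁.1 Δ s hΔ hs) (ih₂.1 Δ s hΔ hs), ih₁.2⟩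
  case idInd =>
    intro Γ A C c a b p i _ _ _ _ _ ih₁ ih₂ ih₃ ih₄ ih₅
    refine ⟨fun Δ s hΔ hs => ?_, ih₃.2⟩
    obtain ⟨_, hI⟩ := ih₁.2 (.id (A.shift 2) (.var 1) (.var 0)) (A.shift 1 :: A :: Γ)
      (List.suffix_refl _)
    obtain ⟨_, hA'⟩ := ih₁.2 (A.shift 1) (A :: Γ) (List.suffix_cons _ _)
    obtain ⟨_, hA⟩ := ih₂.2 A Γ (List.suffix_refl _)
    have h₁ := hA Δ s hΔ hs
    have k₁ := hK.up hs h₁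
    have h₂ := hA' _ _ (.cons h₁) k₁
    have k₂ := hK.up k₁ h₂
    have h₃ := hI _ _ (.cons h₂) k₂
    have h := ih₁.1 _ _ (.cons h₃) (hK.up k₂ h₃)
    have e₂ : act k (Tm.up (Tm.up s)) (A.shift 2) = (act k s A).shift 2 := by
      rw [← shift_shift 1 1, up_shift_act, up_shift_act, shift_shift]
    have e₃ : act k (Tm.up (Tm.up s)) (.id (A.shift 2) (.var 1) (.var 0)) =
        .id ((act k s A).shift 2) (.var 1) (.var 0) := by
      rw [← e₂]; rfl
    rw [up_shift_act, e₃] at h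
    rw [act_inst₃]
    refine .idInd h ?_ (ih₃.1 Δ s hΔ hs) (ih₄.1 Δ s hΔ hs) (ih₅.1 Δ s hΔ hs)
    have hc := ih₂.1 _ _ (.cons h₁) k₁
    rw [act_subst] at hc
    change HasType _ (Tm.act k (Tm.up s) c) (Tm.subst _ (Tm.subst _ _))
    rw [subst_subst]
    convert hc using 2
    funext n
    rcases n with _ | _ | _ | n
    · rfl
    · rfl
    · rfl
    · simp only [Function.comp, Tm.up, scons, shift_shift, act, lift, subst]
      rw [shift, subst_rename, shift_eq_subst]; rfl
  case trunc =>
    intro Γ A i _ ih₁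
    exact ⟨fun Δ s hΔ hs => .trunc (ih₁.1 Δ s hΔ hs), ih₁.2⟩
  case truncIn =>
    intro Γ A a i _ _ ih₁ ih₂
    exact ⟨fun Δ s hΔ hs => .truncIn (ih₁.1 Δ s hΔ hs) (ih₂.1 Δ s hΔ hs), ih₁.2⟩
  case truncPath =>
    intro Γ A a b _ _ ih₁ ih₂
    exact ⟨fun Δ s hΔ hs => .truncPath (ih₁.1 Δ s hΔ hs) (ih₂.1 Δ s hΔ hs), ih₁.2⟩
  case truncRec =>
    intro Γ A B w f t i _ _ _ _ ih₁ ih₂ ih₃ ih₄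
    refine ⟨fun Δ s hΔ hs => ?_, ih₁.2⟩
    have h₂ := ih₂.1 Δ s hΔ hs
    have h₃ := ih₃.1 Δ s hΔ hs
    rw [act_isProp] at h₂
    have e : act k s (.pi A (B.shift 1)) = .pi (act k s A) ((act k s B).shift 1) := by
      rw [← up_shift_act]; rfl
    rw [e] at h₃
    exact .truncRec (ih₁.1 Δ s hΔ hs) h₂ h₃ (ih₄.1 Δ s hΔ hs)
  case funext =>
    intro Γ A B f g i _ _ _ _ ih₁ ih₂ ih₃ ih₄
    refine ⟨fun Δ s hΔ hs => ?_, ih₁.2⟩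
    have h₁ := ih₁.1 Δ s hΔ hs
    rw [act_funext]
    exact .funext h₁ (ih₂.1 _ _ (.cons h₁) (hK.up hs h₁)) (ih₃.1 Δ s hΔ hs) (ih₄.1 Δ s hΔ hs)
  case univalence =>
    intro Γ A B i _ _ ih₁ ih₂
    refine ⟨fun Δ s hΔ hs => ?_, ih₁.2⟩
    rw [act_univalence]
    exact .univalence (ih₁.1 Δ s hΔ hs) (ih₂.1 Δ s hΔ hs)

theorem HasType.act {k K} (hK : Kit k K) {Γ Δ s t A} (h : HasType Γ t A) (hΔ : IsCtx Δ)
    (hs : K Δ s Γ) : HasType Δ (Tm.act k s t) (Tm.act k s A) :=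
  (h.act_aux hK).1 Δ s hΔ hs

theorem IsCtx.of_cons {A Γ} (h : IsCtx (A :: Γ)) : ∃ i, HasType Γ A (.univ i) := by
  cases h with
  | cons h => exact ⟨_, h⟩

/-- Well-typed renamings. -/
def RenTyped (Δ : List Tm) (s : ℕ → Tm) (Γ : List Tm) : Prop :=
  ∀ n A, Γ[n]? = some A → ∃ m B, s n = .var m ∧ Δ[m]? = some B ∧
    B.shift (m + 1) = subst s (A.shift (n + 1))

/-- Renamings come before general substitutions, because extending a substitution under a binder
weakens its terms, and weakening is the case of a renaming. -/
theorem renKit : Kit 0 RenTyped where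
  var := by
    intro Δ s Γ n A hs hΔ hn
    obtain ⟨m, B, e, hm, hB⟩ := hs n A hn
    rw [e, act_zero, ← hB]
    exact .var hΔ hm
  up := by
    intro Δ s Γ A i hs _ n B hn
    cases n with
    | zero =>
      cases hn
      refine ⟨0, _, rfl, rfl, ?_⟩
      rw [subst_up_shift, shift_zero, act_zero]
    | succ n =>
      obtain ⟨m, B', e, hm, hB⟩ := hs n B hn
      refine ⟨m + 1, B', ?_, hm, ?_⟩
      · simp only [Tm.up, e, shift_var]
      · rw [subst_up_shift, ← hB, shift_shift]

theorem RenTyped.shift (Δ : List Tm) (Γ : List Tm) :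
    RenTyped (Δ ++ Γ) (fun n => .var (n + Δ.length)) Γ := by
  intro n A hn
  refine ⟨_, A, rfl, ?_, ?_⟩
  · rw [List.getElem?_append_right (by omega)]; simpa using hn
  · rw [← shift_eq_subst, shift_shift, Nat.add_right_comm]

/-- Weakening. -/
theorem HasType.weaken {Γ t A} (h : HasType Γ t A) (Δ : List Tm) (hΔ : IsCtx (Δ ++ Γ)) :
    HasType (Δ ++ Γ) (t.shift Δ.length) (A.shift Δ.length) := by
  have := h.act renKit hΔ (RenTyped.shift Δ Γ)
  rwa [act_zero, act_zero, ← shift_eq_subst, ← shift_eq_subst] at this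

/-- Well-typed substitutions. -/
def SubTyped (k : ℕ) (Δ : List Tm) (s : ℕ → Tm) (Γ : List Tm) : Prop :=
  ∀ n A, Γ[n]? = some A → HasType Δ (s n) (Tm.act k s (A.shift (n + 1)))

theorem subKit (k : ℕ) : Kit k (SubTyped k) where
  var := by intro Δ s Γ n A hs _ hn; exact hs n A hn
  up := by
    intro Δ s Γ A i hs hA n B hn
    cases n with
    | zero =>
      cases hn
      have := HasType.var (n := 0) (.cons hA) rfl
      rwa [← up_shift_act] at this
    | succ n =>
      rw [← shift_shift 1 (n + 1), up_shift_act]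
      exact (hs n B hn).weaken [_] (.cons hA)

theorem HasType.subst {Γ Δ s t A} (h : HasType Γ t A) (hΔ : IsCtx Δ) (hs : SubTyped 0 Δ s Γ) :
    HasType Δ (t.subst s) (A.subst s) := by
  have := h.act (subKit 0) hΔ hs
  rwa [act_zero, act_zero] at this

theorem SubTyped.id {Γ} (hΓ : IsCtx Γ) : SubTyped 0 Γ .var Γ := by
  intro n A hn
  rw [act_zero, subst_var]
  exact .var hΓ hn

theorem SubTyped.scons {Γ Δ s a A} (hs : SubTyped 0 Δ s Γ) (ha : HasType Δ a (A.subst s)) :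
    SubTyped 0 Δ (Tm.scons a s) (A :: Γ) := by
  intro n B hn
  rw [act_zero, ← shift_shift 1 n, subst_scons_shift_one]
  cases n with
  | zero => cases hn; rw [shift_zero]; exact ha
  | succ n => have := hs n B hn; rwa [act_zero] at this

theorem HasType.inst {Γ A B C t} (hΓ : IsCtx Γ) (h : HasType (A :: Γ) t B)
    (ha : HasType Γ C A) : HasType Γ (t.inst C) (B.inst C) :=
  h.subst hΓ ((SubTyped.id hΓ).scons (by rwa [subst_var]))

/-- Raising the universe levels of a closed derivation. -/
theorem HasType.lift {t A} (h : HasType [] t A) (k : ℕ) : HasType [] (t.lift k) (A.lift k) := by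
  -- On the empty context every substitution is well typed, so only the raising of levels remains.
  have := h.act (subKit k) .nil (s := .var) (by intro n A hn; simp at hn)
  rwa [act_var', act_var'] at this

end HoTT

-- Boolean tests for equality, convertibility and closedness of raw terms.

namespace HoTT

open Tm

namespace Tm

/-- Boolean equality of raw terms. -/
def beq : Tm → Tm → Bool
  | var n, t => match t with | var m => n == m | _ => false
  | univ i, t => match t with | univ j => i == j | _ => false
  | pi A B, t => match t with | pi A' B' => beq A A' && beq B B' | _ => false
  | lam A b, t => match t with | lam A' b' => beq A A' && beq b b' | _ => false
  | app f a, t => match t with | app f' a' => beq f f' && beq a a' | _ => false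
  | sig A B, t => match t with | sig A' B' => beq A A' && beq B B' | _ => false
  | pair a b, t => match t with | pair a' b' => beq a a' && beq b b' | _ => false
  | sigInd C g p, t => match t with
    | sigInd C' g' p' => beq C C' && beq g g' && beq p p'
    | _ => false
  | unit, t => match t with | unit => true | _ => false
  | star, t => match t with | star => true | _ => false
  | id A a b, t => match t with | id A' a' b' => beq A A' && beq a a' && beq b b' | _ => false
  | refl a, t => match t with | refl a' => beq a a' | _ => false
  | idInd C c a b p, t => match t with
    | idInd C' c' a' b' p' => beq C C' && beq c c' && beq a a' && beq b b' && beq p p'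
    | _ => false
  | trunc A, t => match t with | trunc A' => beq A A' | _ => false
  | truncIn a, t => match t with | truncIn a' => beq a a' | _ => false
  | truncPath a b, t => match t with | truncPath a' b' => beq a a' && beq b b' | _ => false
  | truncRec B w f x, t => match t with
    | truncRec B' w' f' x' => beq B B' && beq w w' && beq f f' && beq x x'
    | _ => false
  | funext A B f g, t => match t with
    | funext A' B' f' g' => beq A A' && beq B B' && beq f f' && beq g g'
    | _ => false
  | univalence i A B, t => match t with
    | univalence j A' B' => i == j && beq A A' && beq B B'
    | _ => false
  | _, _ => false

/-- Only this direction is used, so `beq` may answer `false` on the constructors that it leaves out.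
-/
theorem eq_of_beq {a b : Tm} (h : beq a b = true) : a = b := by
  induction a generalizing b <;> unfold beq at h <;> try split at h
  all_goals
    try simp only [Bool.and_eq_true, beq_iff_eq, Bool.false_eq_true] at h
  all_goals grind

/-- Reduction to weak head normal form. -/
def whnf : ℕ → Tm → Tm
  | 0, t => t
  | n + 1, t => match t with
    | app f a => match whnf n f with
      | lam _ b => whnf n (b.inst a)
      | f' => app f' a
    | sigInd C g p => match whnf n p with
      | pair a b => whnf n (g.inst₂ a b)
      | p' => sigInd C g p'
    | idInd C c a b p => match whnf n p with
      | refl x => whnf n (c.inst x)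
      | p' => idInd C c a b p'
    | truncRec B w f x => match whnf n x with
      | truncIn a => whnf n (app f a)
      | x' => truncRec B w f x'
    | t => t

theorem conv_whnf (n : ℕ) (t : Tm) : Conv t (whnf n t) := by
  induction n generalizing t with
  | zero => exact .refl _
  | succ n ih =>
    unfold whnf
    split
    · rename_i f a
      have h := ih f
      split
      · rename_i e
        rw [e] at h
        exact .trans (.app h (.refl _)) (.trans (.beta _ _ _) (ih _))
      · exact .app h (.refl _)
    · rename_i C g p
      have h := ih p
      split
      · rename_i e
        rw [e] at h
        exact .trans (.sigInd (.refl _) (.refl _) h) (.trans (.sigBeta _ _ _ _) (ih _))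
      · exact .sigInd (.refl _) (.refl _) h
    · rename_i C c a b p
      have h := ih p
      split
      · rename_i e
        rw [e] at h
        exact .trans (.idInd (.refl _) (.refl _) (.refl _) (.refl _) h)
          (.trans (.idBeta _ _ _ _ _) (ih _))
      · exact .idInd (.refl _) (.refl _) (.refl _) (.refl _) h
    · rename_i B w f x
      have h := ih x
      split
      · rename_i e
        rw [e] at h
        exact .trans (.truncRec (.refl _) (.refl _) (.refl _) h)
          (.trans (.truncBeta _ _ _ _) (ih _))
      · exact .truncRec (.refl _) (.refl _) (.refl _) h
    · exact .refl _

/-- Comparison of two terms in weak head normal form, for a given comparison `c` of terms. -/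
def convHead (c : Tm → Tm → Bool) : Tm → Tm → Bool
  | lam _ b, t => match t with
    | lam _ b' => c b b'
    | t => c b (app (shift 1 t) (var 0))
  | s, lam _ b => c (app (shift 1 s) (var 0)) b
  | pi A B, t => match t with | pi A' B' => c A A' && c B B' | _ => false
  | app f a, t => match t with | app f' a' => c f f' && c a a' | _ => false
  | sig A B, t => match t with | sig A' B' => c A A' && c B B' | _ => false
  | pair a b, t => match t with | pair a' b' => c a a' && c b b' | _ => false
  | sigInd C g p, t => match t with
    | sigInd C' g' p' => c p p' && c C C' && c g g'
    | _ => false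
  | id A a b, t => match t with | id A' a' b' => c A A' && c a a' && c b b' | _ => false
  | refl a, t => match t with | refl a' => c a a' | _ => false
  | idInd C d a b p, t => match t with
    | idInd C' d' a' b' p' => c p p' && c C C' && c d d' && c a a' && c b b'
    | _ => false
  | trunc A, t => match t with | trunc A' => c A A' | _ => false
  | truncIn a, t => match t with | truncIn a' => c a a' | _ => false
  | truncRec B w f x, t => match t with
    | truncRec B' w' f' x' => c x x' && c B B' && c w w' && c f f'
    | _ => false
  | s, t => beq s t

/-- A sound semi-decision procedure for convertibility. -/
def convb : ℕ → Tm → Tm → Bool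
  | 0, a, b => beq a b
  | n + 1, a, b => beq a b || convHead (convb n) (whnf n a) (whnf n b)

theorem conv_lam_of_eta {A b t : Tm} (h : Conv b (app (shift 1 t) (var 0))) :
    Conv (lam A b) t :=
  .trans (.lam (.refl _) h) (.eta A t)

theorem rename_upRen_inst (t : Tm) : (t.rename (upRen fun n => n + 1)).inst (var 0) = t := by
  rw [inst, subst_rename]
  convert subst_var t using 2
  funext n; cases n <;> rfl

/-- The domains need not be related: by the uniqueness rule the left side is convertible to `t` once
its body is convertible to `t` applied to the last variable, and for `t = lam A' b'` that
application reduces to `b'`. Hence `convHead` ignores domains. -/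
theorem conv_lam {A A' b b' : Tm} (h : Conv b b') : Conv (lam A b) (lam A' b') := by
  refine conv_lam_of_eta (.trans h (.symm ?_))
  have := Conv.beta (rename (fun n => n + 1) A') (b'.rename (upRen fun n => n + 1)) (var 0)
  rwa [rename_upRen_inst] at this

theorem conv_of_convHead {c : Tm → Tm → Bool} (hc : ∀ {a b}, c a b = true → Conv a b)
    {a b : Tm} (h : convHead c a b = true) : Conv a b := by
  unfold convHead at h
  split at h
  · split at h
    · exact conv_lam (hc h)
    · exact conv_lam_of_eta (hc h)
  · exact .symm (conv_lam_of_eta (.symm (hc h)))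
  all_goals
    first
    | (split at h
       · try simp only [Bool.and_eq_true] at h
         first
         | exact .pi (hc h.1) (hc h.2)
         | exact .app (hc h.1) (hc h.2)
         | exact .sig (hc h.1) (hc h.2)
         | exact .pair (hc h.1) (hc h.2)
         | exact .sigInd (hc h.1.2) (hc h.2) (hc h.1.1)
         | exact .id (hc h.1.1) (hc h.1.2) (hc h.2)
         | exact .reflCongr (hc h)
         | exact .idInd (hc h.1.1.1.2) (hc h.1.1.2) (hc h.1.2) (hc h.2) (hc h.1.1.1.1)
         | exact .trunc (hc h)
         | exact .truncIn (hc h)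
         | exact .truncRec (hc h.1.1.2) (hc h.1.2) (hc h.2) (hc h.1.1.1)
       · exact absurd h (by simp))
    | (rw [eq_of_beq h]; exact .refl _)

theorem conv_of_convb {n : ℕ} {a b : Tm} (h : convb n a b = true) : Conv a b := by
  induction n generalizing a b with
  | zero => rw [eq_of_beq h]; exact .refl _
  | succ n ih =>
    rw [convb, Bool.or_eq_true] at h
    rcases h with h | h
    · rw [eq_of_beq h]; exact .refl _
    · exact .trans (conv_whnf n a) (.trans (conv_of_convHead ih h) (.symm (conv_whnf n b)))

/-- All free variables are below `k`. -/
def closedAt : ℕ → Tm → Bool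
  | k, var n => n < k
  | _, univ _ => true
  | k, pi A B => closedAt k A && closedAt (k + 1) B
  | k, lam A b => closedAt k A && closedAt (k + 1) b
  | k, app f a => closedAt k f && closedAt k a
  | k, sig A B => closedAt k A && closedAt (k + 1) B
  | k, pair a b => closedAt k a && closedAt k b
  | k, sigInd C g p => closedAt (k + 1) C && closedAt (k + 2) g && closedAt k p
  | _, unit => true
  | _, star => true
  | k, id A a b => closedAt k A && closedAt k a && closedAt k b
  | k, refl a => closedAt k a
  | k, trunc A => closedAt k A
  | k, truncIn a => closedAt k a
  | _, _ => false

theorem subst_of_closedAt {k : ℕ} {t : Tm} (h : closedAt k t = true) {s : ℕ → Tm}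
    (hs : ∀ n < k, s n = var n) : subst s t = t := by
  have up_eq : ∀ {k : ℕ} {s : ℕ → Tm}, (∀ n < k, s n = var n) → ∀ n < k + 1, up s n = var n := by
    intro k s hs n hn
    cases n with
    | zero => rfl
    | succ n => rw [up, hs n (by omega)]; rfl
  induction t generalizing k s <;>
    simp only [closedAt, Bool.and_eq_true, decide_eq_true_eq, Bool.false_eq_true] at h <;>
    simp only [subst]
  case var n => exact hs n h
  case pi h₁ h₂ => rw [h₁ h.1 hs, h₂ h.2 (up_eq hs)]
  case lam h₁ h₂ => rw [h₁ h.1 hs, h₂ h.2 (up_eq hs)]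
  case app h₁ h₂ => rw [h₁ h.1 hs, h₂ h.2 hs]
  case sig h₁ h₂ => rw [h₁ h.1 hs, h₂ h.2 (up_eq hs)]
  case pair h₁ h₂ => rw [h₁ h.1 hs, h₂ h.2 hs]
  case sigInd h₁ h₂ h₃ => rw [h₁ h.1.1 (up_eq hs), h₂ h.1.2 (up_eq (up_eq hs)), h₃ h.2 hs]
  case id h₁ h₂ h₃ => rw [h₁ h.1.1 hs, h₂ h.1.2 hs, h₃ h.2 hs]
  case refl h₁ => rw [h₁ h hs]
  case trunc h₁ => rw [h₁ h hs]
  case truncIn h₁ => rw [h₁ h hs]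

end Tm

end HoTT

namespace HoTT

open Tm

/-! # Inversion and well-formed types -/

/-- What a derivation of `Γ ⊢ t : T` says about the immediate subterms of `t`. -/
def Inversion (Γ : List Tm) : Tm → Prop
  | .pi A B => ∃ i, HasType Γ A (.univ i) ∧ HasType (A :: Γ) B (.univ i)
  | .sig A B => ∃ i, HasType Γ A (.univ i) ∧ HasType (A :: Γ) B (.univ i)
  | .id A a b => ∃ i, HasType Γ A (.univ i) ∧ HasType Γ a A ∧ HasType Γ b A
  | .trunc A => ∃ i, HasType Γ A (.univ i)
  | _ => True

/-- The rules `conv` and `cumul` change the type but not the term, so what is known about the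
subterms passes through them. -/
theorem HasType.inversion {Γ t A} (h : HasType Γ t A) : Inversion Γ t := by
  refine HasType.rec (motive_1 := fun _ _ => True) (motive_2 := fun Γ t _ _ => Inversion Γ t)
    ?nil ?cons ?var ?conv ?univ ?cumul ?pi ?lam ?app ?sig ?pair ?sigInd ?unit ?star ?unitInd
    ?empty ?emptyInd ?sum ?inl ?inr ?sumInd ?id ?refl ?idInd ?trunc ?truncIn ?truncPath
    ?truncRec ?funext ?univalence h
  case pi => intro Γ A B i h₁ h₂ _ _; exact ⟨i, h₁, h₂⟩
  case sig => intro Γ A B i h₁ h₂ _ _; exact ⟨i, h₁, h₂⟩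
  case id => intro Γ A a b i h₁ h₂ h₃ _ _ _; exact ⟨i, h₁, h₂, h₃⟩
  case trunc => intro Γ A i h₁ _; exact ⟨i, h₁⟩
  case conv => intros; assumption
  case cumul => intros; assumption
  all_goals intros; trivial

theorem HasType.isCtx {Γ t A} (h : HasType Γ t A) : IsCtx Γ := by
  refine (HasType.rec
    (motive_1 := fun Γ _ => IsCtx Γ ∧ IsCtx Γ.tail) (motive_2 := fun Γ _ _ _ => IsCtx Γ ∧ IsCtx Γ.tail)
    ?nil ?cons ?var ?conv ?univ ?cumul ?pi ?lam ?app ?sig ?pair ?sigInd ?unit ?star ?unitInd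
    ?empty ?emptyInd ?sum ?inl ?inr ?sumInd ?id ?refl ?idInd ?trunc ?truncIn ?truncPath
    ?truncRec ?funext ?univalence h).1
  case nil => exact ⟨.nil, .nil⟩
  case cons => intro Γ A i h ih; exact ⟨.cons h, ih.1⟩
  all_goals intros; assumption

/-- `A` is a type in the context `Γ`. -/
def IsType (Γ : List Tm) (A : Tm) : Prop := ∃ i, HasType Γ A (.univ i)

theorem HasType.raise {Γ A i j} (h : HasType Γ A (.univ i)) (hij : i ≤ j) :
    HasType Γ A (.univ j) := by
  induction hij with
  | refl => exact h
  | step _ ih => exact .cumul ih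

theorem IsType.isCtx {Γ A} (h : IsType Γ A) : IsCtx (A :: Γ) := by
  obtain ⟨i, h⟩ := h; exact .cons h

theorem HasType.conv' {Γ a A B} (h : HasType Γ a A) (hB : IsType Γ B) (e : Conv A B) :
    HasType Γ a B := by
  obtain ⟨i, hB⟩ := hB; exact .conv h hB e

theorem IsType.pi {Γ A B} (hA : IsType Γ A) (hB : IsType (A :: Γ) B) : IsType Γ (.pi A B) := by
  obtain ⟨i, hA⟩ := hA
  obtain ⟨j, hB⟩ := hB
  exact ⟨max i j, .pi (hA.raise (le_max_left _ _)) (hB.raise (le_max_right _ _))⟩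

theorem IsType.sig {Γ A B} (hA : IsType Γ A) (hB : IsType (A :: Γ) B) :
    IsType Γ (.sig A B) := by
  obtain ⟨i, hA⟩ := hA
  obtain ⟨j, hB⟩ := hB
  exact ⟨max i j, .sig (hA.raise (le_max_left _ _)) (hB.raise (le_max_right _ _))⟩

theorem IsType.pi_inv {Γ A B} (h : IsType Γ (.pi A B)) : IsType Γ A ∧ IsType (A :: Γ) B := by
  obtain ⟨i, h⟩ := h
  obtain ⟨j, h₁, h₂⟩ := h.inversion
  exact ⟨⟨j, h₁⟩, ⟨j, h₂⟩⟩

theorem IsType.sig_inv {Γ A B} (h : IsType Γ (.sig A B)) : IsType Γ A ∧ IsType (A :: Γ) B := by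
  obtain ⟨i, h⟩ := h
  obtain ⟨j, h₁, h₂⟩ := h.inversion
  exact ⟨⟨j, h₁⟩, ⟨j, h₂⟩⟩

theorem IsType.id_inv {Γ A a b} (h : IsType Γ (.id A a b)) :
    IsType Γ A ∧ HasType Γ a A ∧ HasType Γ b A := by
  obtain ⟨i, h⟩ := h
  obtain ⟨j, h₁, h₂⟩ := h.inversion
  exact ⟨⟨j, h₁⟩, h₂⟩

theorem IsType.trunc_inv {Γ A} (h : IsType Γ (.trunc A)) : IsType Γ A := by
  obtain ⟨i, h⟩ := h
  exact h.inversion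

theorem IsType.inst {Γ A B a} (hΓ : IsCtx Γ) (hB : IsType (A :: Γ) B) (ha : HasType Γ a A) :
    IsType Γ (B.inst a) := by
  obtain ⟨i, hB⟩ := hB
  exact ⟨i, hB.inst hΓ ha⟩

theorem HasType.shift_one {Γ t A B} (h : HasType Γ t A) (hB : IsType Γ B) :
    HasType (B :: Γ) (t.shift 1) (A.shift 1) :=
  h.weaken [B] hB.isCtx

theorem IsType.shift_one {Γ A B} (h : IsType Γ A) (hB : IsType Γ B) :
    IsType (B :: Γ) (A.shift 1) := by
  obtain ⟨i, h⟩ := h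
  exact ⟨i, h.shift_one hB⟩

theorem IsType.of_getElem? {Γ : List Tm} (hΓ : IsCtx Γ) {n : ℕ} {A : Tm} (h : Γ[n]? = some A) :
    IsType Γ (A.shift (n + 1)) := by
  induction Γ generalizing n with
  | nil => simp at h
  | cons B Γ ih =>
    have hB : IsType Γ B := hΓ.of_cons
    cases n with
    | zero => cases h; exact hB.shift_one hB
    | succ n =>
      have hΓ' : IsCtx Γ := by
        obtain ⟨i, hB⟩ := hB
        exact hB.isCtx
      rw [← shift_shift 1 (n + 1)]
      exact (ih hΓ' h).shift_one hB

/-- The type of paths in `A` between the last two variables. -/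
theorem IsType.id_var {Γ A} (hA : IsType Γ A) :
    IsType (A.shift 1 :: A :: Γ) (.id (A.shift 2) (.var 1) (.var 0)) := by
  have h₁ := hA.shift_one hA
  obtain ⟨i, h₂⟩ := h₁.shift_one h₁
  have h₃ : HasType (A.shift 1 :: A :: Γ) (.var 1) (A.shift 2) := .var h₁.isCtx rfl
  have h₄ : HasType (A.shift 1 :: A :: Γ) (.var 0) ((A.shift 1).shift 1) := .var h₁.isCtx rfl
  rw [shift_shift] at h₂ h₄
  exact ⟨i, .id h₂ h₃ h₄⟩

theorem isProp_ofTm (A : Tm) : PTm.isProp (PTm.ofTm A) 0 =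
    .pi A (.pi (A.shift 1) (.id (A.shift 2) (.var 1) (.var 0))) := by
  simp [PTm.isProp, PTm.pi, PTm.id, PTm.ofTm, PTm.bvar, shift_zero]

theorem IsType.isProp {Γ A} (hA : IsType Γ A) : IsType Γ (PTm.isProp (PTm.ofTm A) 0) := by
  rw [isProp_ofTm]
  exact hA.pi ((hA.shift_one hA).pi hA.id_var)

theorem SubTyped.weaken {Γ : List Tm} (Δ : List Tm) (hΔ : IsCtx (Δ ++ Γ)) :
    SubTyped 0 (Δ ++ Γ) (fun n => .var (n + Δ.length)) Γ := by
  intro n A hn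
  rw [act_zero, ← shift_eq_subst, shift_shift, Nat.add_right_comm]
  refine .var hΔ ?_
  rw [List.getElem?_append_right (by omega)]
  simpa using hn

theorem IsType.subst {Γ Δ s A} (h : IsType Γ A) (hΔ : IsCtx Δ) (hs : SubTyped 0 Δ s Γ) :
    IsType Δ (A.subst s) := by
  obtain ⟨i, h⟩ := h
  exact ⟨i, h.subst hΔ hs⟩

/-- Soundness of checking presupposes that the expected type is a type. This lemma and the next one
supply that for the branches of `Σ`-induction and path induction. -/
theorem IsType.subst_pair {Γ A B C} (hS : IsType Γ (.sig A B)) (hC : IsType (.sig A B :: Γ) C) :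
    IsType (B :: A :: Γ)
      (C.subst (scons (.pair (.var 1) (.var 0)) fun n => .var (n + 2))) := by
  obtain ⟨_, hB⟩ := hS.sig_inv
  have hΔ := hB.isCtx
  refine hC.subst hΔ ((SubTyped.weaken [B, A] hΔ).scons ?_)
  obtain ⟨i, h⟩ := hS.subst hΔ (SubTyped.weaken [B, A] hΔ)
  obtain ⟨j, h₁, h₂⟩ := h.inversion
  refine .pair h₁ h₂ ?_ ?_
  · rw [← shift_eq_subst]
    exact .var hΔ rfl
  · have e : (B.subst (Tm.up fun n => .var (n + [B, A].length))).inst (.var 1) = B.shift 1 := by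
      rw [Tm.inst, subst_subst, shift_eq_subst]
      congr 1; funext n; cases n <;> rfl
    rw [e]
    exact .var hΔ rfl

theorem IsType.subst_refl {Γ A C} (hA : IsType Γ A)
    (hC : IsType (.id (A.shift 2) (.var 1) (.var 0) :: A.shift 1 :: A :: Γ) C) :
    IsType (A :: Γ) (C.subst (scons (.refl (.var 0)) (scons (.var 0)
      (scons (.var 0) fun n => .var (n + 1))))) := by
  have hΔ := hA.isCtx
  have h₀ : HasType (A :: Γ) (.var 0) (A.shift 1) := .var hΔ rfl
  obtain ⟨i, h₁⟩ := hA.shift_one hA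
  refine hC.subst hΔ ((((SubTyped.weaken [A] hΔ).scons ?_).scons ?_).scons ?_)
  · rwa [← shift_eq_subst]
  · rwa [subst_scons_shift_one, ← shift_eq_subst]
  · rw [Tm.subst, ← shift_shift 1 1, subst_scons_shift_one, subst_scons_shift_one,
      ← shift_eq_subst]
    exact .refl h₁ h₀

theorem IsType.inst₃ {Γ A C a b p} (hΓ : IsCtx Γ)
    (hC : IsType (.id (A.shift 2) (.var 1) (.var 0) :: A.shift 1 :: A :: Γ) C)
    (ha : HasType Γ a A) (hb : HasType Γ b A) (hp : HasType Γ p (.id A a b)) :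
    IsType Γ (C.inst₃ a b p) := by
  refine hC.subst hΓ ((((SubTyped.id hΓ).scons ?_).scons ?_).scons ?_)
  · rwa [subst_var]
  · rwa [subst_scons_shift_one, subst_var]
  · rw [Tm.subst, ← shift_shift 1 1, subst_scons_shift_one, subst_scons_shift_one, subst_var]
    exact hp

/-- Gives the motive for eliminating the last variable: its occurrences in `T` are moved to a fresh
variable, whose type is the `Σ`-type convertible to `X`. -/
theorem IsType.rename_upRen {X Γ A B T} (hT : IsType (X :: Γ) T)
    (hS : IsType (X :: Γ) (.sig A B)) (e : Conv (X.shift 1) (.sig A B)) :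
    IsType (.sig A B :: X :: Γ) (T.rename (upRen fun n => n + 1)) := by
  have hΔ := hS.isCtx
  have hs : (var ∘ upRen fun n => n + 1) = scons (.var 0) fun n => .var (n + 2) := by
    funext n; cases n <;> rfl
  have hX : IsType (.sig A B :: X :: Γ) (X.subst fun n => .var (n + 2)) := by
    obtain ⟨i, hS⟩ := hS
    have hX : IsType Γ X := by
      have hΓ := hS.isCtx
      exact hΓ.of_cons
    exact hX.subst hΔ (SubTyped.weaken [.sig A B, X] hΔ)
  rw [rename_eq_subst, hs]
  refine hT.subst hΔ ((SubTyped.weaken [.sig A B, X] hΔ).scons ?_)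
  have h₀ : HasType (.sig A B :: X :: Γ) (.var 0) ((Tm.sig A B).shift 1) := .var hΔ rfl
  refine h₀.conv' hX ?_
  have := e.symm.act 0 fun n => .var (n + 1)
  rwa [act_zero, act_zero, ← shift_eq_subst, ← shift_eq_subst, shift_shift, shift_eq_subst 2]
    at this

/-! # An elaborating type checker

The checker computes the domains of abstractions and the motives of eliminators from the expected
type.  Terms given to it may contain arbitrary terms in these places. -/

namespace Checker

/-- Type inference: the elaborated term and its type. -/
abbrev Inf : Type := List Tm → Tm → Option (Tm × Tm)

/-- Checking of a term against a type: the elaborated term. -/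
abbrev Chk : Type := List Tm → Tm → Tm → Option Tm

/-- A bound for the number of reduction steps. -/
def bound : ℕ := 100000

/-- The elaboration of a type, and its universe level. -/
def kind (inf : Inf) (Γ : List Tm) (A : Tm) : Option (Tm × ℕ) :=
  (inf Γ A).bind fun r => match whnf bound r.2 with
    | .univ i => some (r.1, i)
    | _ => none

/-- A type former that the type `A` reduces to. -/
def expose (inf : Inf) (Γ : List Tm) (A : Tm) : Option Tm :=
  match A with
  | .pi _ _ => some A
  | .sig _ _ => some A
  | .id _ _ _ => some A
  | .trunc _ => some A
  | _ => (kind inf Γ (whnf bound A)).bind fun r =>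
      if convb bound r.1 A then some r.1 else none

/-- The motive of a projection out of `Σ (x : A), B`. -/
def projMotive (A B C g : Tm) : Tm :=
  match C with
  | .star => match g with
    | .var 1 => A.shift 1
    | _ => B.subst (scons (.sigInd (A.shift 2) (.var 1) (.var 0)) fun n => .var (n + 1))
  | _ => C

/-- One step of type inference. -/
def inferStep (inf : Inf) (chk : Chk) (Γ : List Tm) (t : Tm) : Option (Tm × Tm) :=
  match t with
  | .var n => match Γ[n]? with
    | some A => some (.var n, A.shift (n + 1))
    | none => none
  | .univ i => some (.univ i, .univ (i + 1))
  | .pi A B =>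
    (kind inf Γ A).bind fun r => (kind inf (r.1 :: Γ) B).bind fun q =>
      some (.pi r.1 q.1, .univ (max r.2 q.2))
  | .lam A b =>
    (kind inf Γ A).bind fun r => (inf (r.1 :: Γ) b).bind fun q =>
      some (.lam r.1 q.1, .pi r.1 q.2)
  | .app f a =>
    (inf Γ f).bind fun r => match expose inf Γ r.2 with
      | some (.pi A B) => (chk Γ a A).bind fun a' => some (.app r.1 a', B.inst a')
      | _ => none
  | .sig A B =>
    (kind inf Γ A).bind fun r => (kind inf (r.1 :: Γ) B).bind fun q =>
      some (.sig r.1 q.1, .univ (max r.2 q.2))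
  | .pair a b =>
    (inf Γ a).bind fun r => (inf Γ b).bind fun q =>
      some (.pair r.1 q.1, .sig r.2 (q.2.shift 1))
  | .sigInd C g p =>
    (inf Γ p).bind fun r => match expose inf Γ r.2 with
      | some (.sig A B) => (kind inf (.sig A B :: Γ) (projMotive A B C g)).bind fun q =>
        (chk (B :: A :: Γ) g
          (q.1.subst (scons (.pair (.var 1) (.var 0)) fun n => .var (n + 2)))).bind fun g' =>
        some (.sigInd q.1 g' r.1, q.1.inst r.1)
      | _ => none
  | .unit => some (.unit, .univ 0)
  | .star => some (.star, .unit)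
  | .id A a b =>
    (kind inf Γ A).bind fun r => (chk Γ a r.1).bind fun a' => (chk Γ b r.1).bind fun b' =>
      some (.id r.1 a' b', .univ r.2)
  | .refl a => (inf Γ a).bind fun r => some (.refl r.1, .id r.2 r.1 r.1)
  | .idInd C c _ _ p =>
    (inf Γ p).bind fun r => match expose inf Γ r.2 with
      | some (.id A a b) =>
        (kind inf (.id (A.shift 2) (.var 1) (.var 0) :: A.shift 1 :: A :: Γ) C).bind fun q =>
        (chk (A :: Γ) c (q.1.subst (scons (.refl (.var 0)) (scons (.var 0)
          (scons (.var 0) fun n => .var (n + 1)))))).bind fun c' =>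
        some (.idInd q.1 c' a b r.1, q.1.inst₃ a b r.1)
      | _ => none
  | .trunc A => (kind inf Γ A).bind fun r => some (.trunc r.1, .univ r.2)
  | .truncIn a => (inf Γ a).bind fun r => some (.truncIn r.1, .trunc r.2)
  | .truncRec B w f x =>
    (kind inf Γ B).bind fun q => (chk Γ w (PTm.isProp (PTm.ofTm q.1) 0)).bind fun w' =>
    (inf Γ x).bind fun r => match expose inf Γ r.2 with
      | some (.trunc A) => (chk Γ f (.pi A (q.1.shift 1))).bind fun f' =>
        some (.truncRec q.1 w' f' r.1, q.1)
      | _ => none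
  | .funext A B f g =>
    (kind inf Γ A).bind fun r => (kind inf (r.1 :: Γ) B).bind fun q =>
    (chk Γ f (.pi r.1 q.1)).bind fun f' => (chk Γ g (.pi r.1 q.1)).bind fun g' =>
    let T := PTm.isEquiv
      (PTm.id (PTm.ofTm (.pi r.1 q.1)) (PTm.ofTm f') (PTm.ofTm g'))
      (PTm.pi (PTm.ofTm r.1) fun x =>
        PTm.id (PTm.ofFam q.1 x) (PTm.app (PTm.ofTm f') x) (PTm.app (PTm.ofTm g') x))
      (PTm.happly (PTm.ofTm r.1) (PTm.ofFam q.1) (PTm.ofTm f') (PTm.ofTm g')) 0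
    (kind inf Γ T).bind fun u =>
      if convb bound T u.1 then some (.funext r.1 q.1 f' g', u.1) else none
  | .univalence i A B =>
    (chk Γ A (.univ i)).bind fun A' => (chk Γ B (.univ i)).bind fun B' =>
    let T := PTm.isEquiv
      (PTm.id (PTm.univ i) (PTm.ofTm A') (PTm.ofTm B'))
      (PTm.equiv (PTm.ofTm A') (PTm.ofTm B'))
      (PTm.idToEquiv i (PTm.ofTm A') (PTm.ofTm B')) 0
    (kind inf Γ T).bind fun u =>
      if convb bound T u.1 then some (.univalence i A' B', u.1) else none
  | _ => none

/-- Checking of a term whose type can be inferred. -/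
def fallback (inf : Inf) (Γ : List Tm) (t T : Tm) : Option Tm :=
  (inf Γ t).bind fun r =>
    if convb bound r.2 T then some r.1
    else match whnf bound r.2 with
      | .univ i => match whnf bound T with
        | .univ j => if i ≤ j then some r.1 else none
        | _ => none
      | _ => none

/-- One step of checking.  A `Σ`-induction with motive `1` eliminates the last variable, the
application of an abstraction over `1` to the last variable generalizes over this variable, and
the motive `⋆` of a truncation recursion stands for the expected type. -/
def checkStep (inf : Inf) (chk : Chk) (Γ : List Tm) (t T : Tm) : Option Tm :=
  match t with
  | .lam _ b => match expose inf Γ T with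
    | some (.pi A B) => (chk (A :: Γ) b B).bind fun b' => some (.lam A b')
    | _ => none
  | .pair a b => match expose inf Γ T with
    | some (.sig A B) => (chk Γ a A).bind fun a' => (chk Γ b (B.inst a')).bind fun b' =>
      some (.pair a' b')
    | _ => none
  | .refl _ => match expose inf Γ T with
    | some (.id _ a b) => if convb bound a b then some (.refl a) else none
    | _ => none
  | .truncIn a => match expose inf Γ T with
    | some (.trunc A) => (chk Γ a A).bind fun a' => some (.truncIn a')
    | _ => none
  | .truncPath _ _ => match expose inf Γ T with
    | some (.id X a b) => match expose inf Γ X with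
      | some (.trunc _) => some (.truncPath a b)
      | _ => none
    | _ => none
  | .sigInd .unit g _ => match Γ with
    | X :: _ => match expose inf Γ (X.shift 1) with
      | some (.sig A B) =>
        let C := T.rename (upRen fun n => n + 1)
        (chk (B :: A :: Γ) g
          (C.subst (scons (.pair (.var 1) (.var 0)) fun n => .var (n + 2)))).bind fun g' =>
        some (.sigInd C g' (.var 0))
      | _ => none
    | _ => none
  | .app (.lam .unit b) (.var 0) => match Γ with
    | X :: Γ' => (chk Γ' b (.pi X T)).bind fun b' => some (.app (b'.shift 1) (.var 0))
    | _ => none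
  | .truncRec .star w f x => (inf Γ x).bind fun r => match expose inf Γ r.2 with
    | some (.trunc A) => (chk Γ w (PTm.isProp (PTm.ofTm T) 0)).bind fun w' =>
      (chk Γ f (.pi A (T.shift 1))).bind fun f' => some (.truncRec T w' f' r.1)
    | _ => none
  | _ => fallback inf Γ t T

/-- The checker, for a given bound for the depth of terms. -/
def run : ℕ → Inf × Chk
  | 0 => (fun _ _ => none, fun _ _ _ => none)
  | n + 1 => (inferStep (run n).1 (run n).2, checkStep (run n).1 (run n).2)

/-- Soundness of type inference. -/
def SoundInf (inf : Inf) : Prop :=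
  ∀ ⦃Γ t r⦄, IsCtx Γ → inf Γ t = some r → HasType Γ r.1 r.2 ∧ IsType Γ r.2

/-- Soundness of checking. -/
def SoundChk (chk : Chk) : Prop :=
  ∀ ⦃Γ t T r⦄, IsCtx Γ → IsType Γ T → chk Γ t T = some r → HasType Γ r T

section

variable {inf : Inf} {chk : Chk} (hi : SoundInf inf) (hc : SoundChk chk)
include hi

theorem kind_sound {Γ A r} (hΓ : IsCtx Γ) (h : kind inf Γ A = some r) :
    HasType Γ r.1 (.univ r.2) := by
  obtain ⟨q, hq, h⟩ := Option.bind_eq_some_iff.1 h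
  split at h
  · rename_i i e
    cases h
    have c := conv_whnf bound q.2
    rw [e] at c
    exact (hi hΓ hq).1.conv' ⟨_, .univ i hΓ⟩ c
  · cases h

/-- Subject reduction is not available and not needed: unless `A` already is a type former, its
reduct is elaborated again, which shows it to be a type, and the result is compared with `A`. -/
theorem expose_sound {Γ A T} (hΓ : IsCtx Γ) (hA : IsType Γ A) (h : expose inf Γ A = some T) :
    Conv A T ∧ IsType Γ T := by
  unfold expose at h
  split at h
  iterate 4
    cases h
    exact ⟨.refl _, hA⟩
  obtain ⟨q, hq, h⟩ := Option.bind_eq_some_iff.1 h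
  split at h
  · rename_i e
    cases h
    exact ⟨.symm (conv_of_convb e), _, kind_sound hi hΓ hq⟩
  · cases h

theorem fallback_sound {Γ t T r} (hΓ : IsCtx Γ) (hT : IsType Γ T)
    (h : fallback inf Γ t T = some r) : HasType Γ r T := by
  obtain ⟨q, hq, h⟩ := Option.bind_eq_some_iff.1 h
  split at h
  · rename_i e
    cases h
    exact (hi hΓ hq).1.conv' hT (conv_of_convb e)
  · split at h
    · rename_i i e
      split at h
      · rename_i j e'
        split at h
        · rename_i hij
          cases h
          have c := conv_whnf bound q.2
          have c' := conv_whnf bound T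
          rw [e] at c
          rw [e'] at c'
          exact (((hi hΓ hq).1.conv' ⟨_, .univ i hΓ⟩ c).raise hij).conv' hT (.symm c')
        · cases h
      · cases h
    · cases h

include hc

theorem inferStep_sound : SoundInf (inferStep inf chk) := by
  intro Γ t r hΓ h
  unfold inferStep at h
  split at h
  · split at h
    · rename_i e
      cases h
      exact ⟨.var hΓ e, .of_getElem? hΓ e⟩
    · cases h
  · cases h
    exact ⟨.univ _ hΓ, _, .univ _ hΓ⟩
  · obtain ⟨r, hr, h⟩ := Option.bind_eq_some_iff.1 h
    obtain ⟨q, hq, h⟩ := Option.bind_eq_some_iff.1 h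
    cases h
    have h₁ := kind_sound hi hΓ hr
    have h₂ := kind_sound hi (.cons h₁) hq
    exact ⟨.pi (h₁.raise (le_max_left _ _)) (h₂.raise (le_max_right _ _)), _, .univ _ hΓ⟩
  · obtain ⟨r, hr, h⟩ := Option.bind_eq_some_iff.1 h
    obtain ⟨q, hq, h⟩ := Option.bind_eq_some_iff.1 h
    cases h
    have h₁ := kind_sound hi hΓ hr
    obtain ⟨h₂, h₃⟩ := hi (.cons h₁) hq
    exact ⟨.lam h₁ h₂, IsType.pi ⟨_, h₁⟩ h₃⟩
  · obtain ⟨r, hr, h⟩ := Option.bind_eq_some_iff.1 h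
    obtain ⟨h₁, h₂⟩ := hi hΓ hr
    split at h
    · rename_i A B e
      obtain ⟨a, ha, h⟩ := Option.bind_eq_some_iff.1 h
      cases h
      obtain ⟨c, hT⟩ := expose_sound hi hΓ h₂ e
      have ha := hc hΓ hT.pi_inv.1 ha
      exact ⟨.app (h₁.conv' hT c) ha, hT.pi_inv.2.inst hΓ ha⟩
    · cases h
  · obtain ⟨r, hr, h⟩ := Option.bind_eq_some_iff.1 h
    obtain ⟨q, hq, h⟩ := Option.bind_eq_some_iff.1 h
    cases h
    have h₁ := kind_sound hi hΓ hr
    have h₂ := kind_sound hi (.cons h₁) hq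
    exact ⟨.sig (h₁.raise (le_max_left _ _)) (h₂.raise (le_max_right _ _)), _, .univ _ hΓ⟩
  · obtain ⟨r, hr, h⟩ := Option.bind_eq_some_iff.1 h
    obtain ⟨q, hq, h⟩ := Option.bind_eq_some_iff.1 h
    cases h
    obtain ⟨h₁, h₂⟩ := hi hΓ hr
    obtain ⟨h₃, h₄⟩ := hi hΓ hq
    have h₅ := h₄.shift_one h₂
    have h₆ := h₂.sig h₅
    obtain ⟨i, hS⟩ := id h₆
    obtain ⟨j, k₁, k₂⟩ := hS.inversion
    exact ⟨.pair k₁ k₂ h₁ (by rwa [shift_one_inst]), h₆⟩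
  · obtain ⟨r, hr, h⟩ := Option.bind_eq_some_iff.1 h
    obtain ⟨h₁, h₂⟩ := hi hΓ hr
    split at h
    · rename_i A B e
      obtain ⟨q, hq, h⟩ := Option.bind_eq_some_iff.1 h
      obtain ⟨g, hg, h⟩ := Option.bind_eq_some_iff.1 h
      cases h
      obtain ⟨c, hT⟩ := expose_sound hi hΓ h₂ e
      have hC := kind_sound hi hT.isCtx hq
      have hp := h₁.conv' hT c
      have hg := hc hT.sig_inv.2.isCtx (hT.subst_pair ⟨_, hC⟩) hg
      exact ⟨.sigInd hC hg hp, IsType.inst hΓ ⟨_, hC⟩ hp⟩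
    · cases h
  · cases h; exact ⟨.unit 0 hΓ, _, .univ 0 hΓ⟩
  · cases h; exact ⟨.star hΓ, _, .unit 0 hΓ⟩
  · obtain ⟨r, hr, h⟩ := Option.bind_eq_some_iff.1 h
    obtain ⟨a, ha, h⟩ := Option.bind_eq_some_iff.1 h
    obtain ⟨b, hb, h⟩ := Option.bind_eq_some_iff.1 h
    cases h
    have h₁ := kind_sound hi hΓ hr
    exact ⟨.id h₁ (hc hΓ ⟨_, h₁⟩ ha) (hc hΓ ⟨_, h₁⟩ hb), _, .univ _ hΓ⟩
  · obtain ⟨r, hr, h⟩ := Option.bind_eq_some_iff.1 h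
    cases h
    obtain ⟨h₁, i, h₂⟩ := hi hΓ hr
    exact ⟨.refl h₂ h₁, _, .id h₂ h₁ h₁⟩
  · obtain ⟨r, hr, h⟩ := Option.bind_eq_some_iff.1 h
    obtain ⟨h₁, h₂⟩ := hi hΓ hr
    split at h
    · rename_i A a b e
      obtain ⟨q, hq, h⟩ := Option.bind_eq_some_iff.1 h
      obtain ⟨d, hd, h⟩ := Option.bind_eq_some_iff.1 h
      cases h
      obtain ⟨c, hT⟩ := expose_sound hi hΓ h₂ e
      obtain ⟨hA, ha, hb⟩ := hT.id_inv
      have hC := kind_sound hi hA.id_var.isCtx hq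
      have hd := hc hA.isCtx (hA.subst_refl ⟨_, hC⟩) hd
      have hp := h₁.conv' hT c
      exact ⟨.idInd hC hd ha hb hp, IsType.inst₃ hΓ ⟨_, hC⟩ ha hb hp⟩
    · cases h
  · obtain ⟨r, hr, h⟩ := Option.bind_eq_some_iff.1 h
    cases h
    exact ⟨.trunc (kind_sound hi hΓ hr), _, .univ _ hΓ⟩
  · obtain ⟨r, hr, h⟩ := Option.bind_eq_some_iff.1 h
    cases h
    obtain ⟨h₁, i, h₂⟩ := hi hΓ hr
    exact ⟨.truncIn h₂ h₁, _, .trunc h₂⟩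
  · obtain ⟨q, hq, h⟩ := Option.bind_eq_some_iff.1 h
    obtain ⟨w, hw, h⟩ := Option.bind_eq_some_iff.1 h
    obtain ⟨r, hr, h⟩ := Option.bind_eq_some_iff.1 h
    have h₀ := kind_sound hi hΓ hq
    have k₀ : IsType Γ q.1 := ⟨_, h₀⟩
    obtain ⟨h₁, h₂⟩ := hi hΓ hr
    split at h
    · rename_i A e
      obtain ⟨f, hf, h⟩ := Option.bind_eq_some_iff.1 h
      cases h
      obtain ⟨c, hT⟩ := expose_sound hi hΓ h₂ e
      exact ⟨.truncRec h₀ (hc hΓ k₀.isProp hw)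
        (hc hΓ (hT.trunc_inv.pi (k₀.shift_one hT.trunc_inv)) hf) (h₁.conv' hT c), k₀⟩
    · cases h
  · obtain ⟨r, hr, h⟩ := Option.bind_eq_some_iff.1 h
    obtain ⟨q, hq, h⟩ := Option.bind_eq_some_iff.1 h
    obtain ⟨f, hf, h⟩ := Option.bind_eq_some_iff.1 h
    obtain ⟨g, hg, h⟩ := Option.bind_eq_some_iff.1 h
    obtain ⟨u, hu, h⟩ := Option.bind_eq_some_iff.1 h
    split at h
    · rename_i e
      cases h
      have h₁ := kind_sound hi hΓ hr
      have h₂ := kind_sound hi (.cons h₁) hq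
      have hP : IsType Γ (.pi r.1 q.1) := IsType.pi ⟨_, h₁⟩ ⟨_, h₂⟩
      obtain ⟨i, hP'⟩ := id hP
      obtain ⟨j, k₁, k₂⟩ := hP'.inversion
      -- The rule for the constant does not say that its type is a type; this comes from having
      -- elaborated that type separately.
      have hT : IsType Γ u.1 := ⟨_, kind_sound hi hΓ hu⟩
      exact ⟨(HasType.funext k₁ k₂ (hc hΓ hP hf) (hc hΓ hP hg)).conv' hT (conv_of_convb e), hT⟩
    · cases h
  · obtain ⟨A, hA, h⟩ := Option.bind_eq_some_iff.1 h
    obtain ⟨B, hB, h⟩ := Option.bind_eq_some_iff.1 h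
    obtain ⟨u, hu, h⟩ := Option.bind_eq_some_iff.1 h
    split at h
    · rename_i e
      cases h
      have hU : ∀ i, IsType Γ (.univ i) := fun i => ⟨_, .univ i hΓ⟩
      have hT : IsType Γ u.1 := ⟨_, kind_sound hi hΓ hu⟩
      exact ⟨(HasType.univalence (hc hΓ (hU _) hA) (hc hΓ (hU _) hB)).conv' hT (conv_of_convb e), hT⟩
    · cases h
  · cases h

theorem checkStep_sound : SoundChk (checkStep inf chk) := by
  intro Γ t T r hΓ hT h
  unfold checkStep at h
  split at h
  · split at h
    · rename_i A B e
      obtain ⟨b, hb, h⟩ := Option.bind_eq_some_iff.1 h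
      cases h
      obtain ⟨c, hP⟩ := expose_sound hi hΓ hT e
      obtain ⟨i, hA⟩ := hP.pi_inv.1
      exact (HasType.lam hA (hc (.cons hA) hP.pi_inv.2 hb)).conv' hT c.symm
    · cases h
  · split at h
    · rename_i A B e
      obtain ⟨a, ha, h⟩ := Option.bind_eq_some_iff.1 h
      obtain ⟨b, hb, h⟩ := Option.bind_eq_some_iff.1 h
      cases h
      obtain ⟨c, i, hP⟩ := expose_sound hi hΓ hT e
      obtain ⟨j, h₁, h₂⟩ := hP.inversion
      have ha := hc hΓ ⟨_, h₁⟩ ha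
      exact (HasType.pair h₁ h₂ ha (hc hΓ (IsType.inst hΓ ⟨_, h₂⟩ ha) hb)).conv' hT c.symm
    · cases h
  · split at h
    · rename_i A a b e
      split at h
      · rename_i e'
        cases h
        obtain ⟨c, hP⟩ := expose_sound hi hΓ hT e
        obtain ⟨⟨i, hA⟩, ha, hb⟩ := hP.id_inv
        exact (HasType.refl hA ha).conv' hT
          (.trans (.id (.refl _) (.refl _) (conv_of_convb e')) c.symm)
      · cases h
    · cases h
  · split at h
    · rename_i A e
      obtain ⟨a, ha, h⟩ := Option.bind_eq_some_iff.1 h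
      cases h
      obtain ⟨c, hP⟩ := expose_sound hi hΓ hT e
      obtain ⟨i, hA⟩ := hP.trunc_inv
      exact (HasType.truncIn hA (hc hΓ ⟨_, hA⟩ ha)).conv' hT c.symm
    · cases h
  · split at h
    · rename_i X a b e
      split at h
      · rename_i A e'
        cases h
        obtain ⟨c, hP⟩ := expose_sound hi hΓ hT e
        obtain ⟨hX, ha, hb⟩ := hP.id_inv
        obtain ⟨c', hA⟩ := expose_sound hi hΓ hX e'
        exact (HasType.truncPath (ha.conv' hA c') (hb.conv' hA c')).conv' hT
          (.trans (.id c'.symm (.refl _) (.refl _)) c.symm)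
      · cases h
    · cases h
  · split at h
    · rename_i X Γ'
      split at h
      · rename_i A B e
        obtain ⟨g, hg, h⟩ := Option.bind_eq_some_iff.1 h
        cases h
        have hX : IsType (X :: Γ') (X.shift 1) := .of_getElem? hΓ (n := 0) rfl
        obtain ⟨c, hS⟩ := expose_sound hi hΓ hX e
        have hC := hT.rename_upRen hS c
        have hg := hc hS.sig_inv.2.isCtx (hS.subst_pair hC) hg
        obtain ⟨i, hC⟩ := hC
        have hp : HasType (X :: Γ') (.var 0) (.sig A B) :=
          (HasType.var (n := 0) hΓ rfl).conv' hS c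
        have := HasType.sigInd hC hg hp
        -- Instantiating the motive at the eliminated variable gives back the expected type.
        rwa [rename_upRen_inst] at this
      · cases h
    · cases h
  · split at h
    · rename_i X Γ'
      obtain ⟨b, hb, h⟩ := Option.bind_eq_some_iff.1 h
      cases h
      have hX : IsType Γ' X := hΓ.of_cons
      obtain ⟨i, hX'⟩ := id hX
      have hb := (hc hX'.isCtx (hX.pi hT) hb).shift_one hX
      have := HasType.app (A := X.shift 1) (B := T.rename (upRen fun n => n + 1)) hb
        (HasType.var (n := 0) hΓ rfl)
      rwa [rename_upRen_inst] at this
    · cases h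
  · obtain ⟨r, hr, h⟩ := Option.bind_eq_some_iff.1 h
    obtain ⟨h₁, h₂⟩ := hi hΓ hr
    split at h
    · rename_i A e
      obtain ⟨w, hw, h⟩ := Option.bind_eq_some_iff.1 h
      obtain ⟨f, hf, h⟩ := Option.bind_eq_some_iff.1 h
      cases h
      obtain ⟨c, hP⟩ := expose_sound hi hΓ h₂ e
      have hA := hP.trunc_inv
      have hf := hc hΓ (hA.pi (hT.shift_one hA)) hf
      have hw := hc hΓ hT.isProp hw
      obtain ⟨i, hT⟩ := hT
      exact .truncRec hT hw hf (h₁.conv' hP c)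
    · cases h
  · exact fallback_sound hi hΓ hT h

end

theorem run_sound (n : ℕ) : SoundInf (run n).1 ∧ SoundChk (run n).2 := by
  induction n with
  | zero => exact ⟨fun _ _ _ _ h => (Option.some_ne_none _ h.symm).elim,
      fun _ _ _ _ _ _ h => (Option.some_ne_none _ h.symm).elim⟩
  | succ n ih => exact ⟨inferStep_sound ih.1 ih.2, checkStep_sound ih.1 ih.2⟩

/-- `T` is a type in the context `Γ`. -/
def checkType (Γ : List Tm) (T : Tm) : Bool :=
  match kind (run bound).1 Γ T with
  | some r => beq r.1 T
  | none => false

/-- The type `T` has an element in the context `Γ`, which `t` elaborates to. -/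
def checkTerm (Γ : List Tm) (T t : Tm) : Bool := ((run bound).2 Γ t T).isSome

theorem checkType_sound {Γ T} (hΓ : IsCtx Γ) (h : checkType Γ T = true) : IsType Γ T := by
  unfold checkType at h
  split at h
  · rename_i r e
    rw [← eq_of_beq h]
    exact ⟨_, kind_sound (run_sound _).1 hΓ e⟩
  · cases h

theorem checkTerm_sound {Γ T t} (hΓ : IsCtx Γ) (hT : IsType Γ T)
    (h : checkTerm Γ T t = true) : ∃ a, HasType Γ a T := by
  obtain ⟨a, ha⟩ := Option.isSome_iff_exists.1 h
  exact ⟨a, (run_sound _).2 hΓ hT ha⟩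

end Checker

/-- A context all of whose types have elements in the empty context. -/
def Inhabited (Γ : List Tm) : Prop := IsCtx Γ ∧ ∃ s, SubTyped 0 [] s Γ

theorem Inhabited.nil : Inhabited [] :=
  ⟨.nil, .var, fun _ _ h => by simp at h⟩

/-- The lemma is checked with all earlier lemmas as opaque variables. Its proof becomes closed when
the closed proofs already found are substituted for them, so the checker never unfolds a previous
proof. -/
theorem Inhabited.cons {Γ} (h : Inhabited Γ) (T t : Tm) (hT : Checker.checkType Γ T = true)
    (ht : Checker.checkTerm Γ T t = true) : Inhabited (T :: Γ) := by
  obtain ⟨hΓ, s, hs⟩ := h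
  have hT := Checker.checkType_sound hΓ hT
  obtain ⟨a, ha⟩ := Checker.checkTerm_sound hΓ hT ht
  exact ⟨hT.isCtx, _, hs.scons (ha.subst .nil hs)⟩

/-- The proof may use the other lemmas of the context, but a closed statement is not affected by
substituting for them. -/
theorem Inhabited.exists {Γ T} (h : Inhabited (T :: Γ)) (hT : closedAt 0 T = true) :
    ∃ a, HasType [] a T := by
  obtain ⟨_, s, hs⟩ := h
  have := hs 0 T rfl
  rw [act_zero, shift, subst_rename, subst_of_closedAt hT (by simp)] at this
  exact ⟨_, this⟩

end HoTT

-- Lists of lemmas as contexts, and the lemmas of homotopy type theory.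

namespace HoTT

/-- A context of types that may refer to the preceding variables, given in reverse order. -/
def context : List PTm → List Tm
  | [] => []
  | T :: Ts => T Ts.length :: context Ts

/-- Lemmas with their proofs, the last one first, in the context of the types `Ts`. -/
def checkLemmas (Ts : List PTm) : List (PTm × PTm) → Bool
  | [] => true
  | l :: ls =>
    let Γ := context (ls.map Prod.fst ++ Ts)
    checkLemmas Ts ls && Checker.checkType Γ (l.1 Γ.length) &&
      Checker.checkTerm Γ (l.1 Γ.length) (l.2 Γ.length)

theorem length_context (Ts : List PTm) : (context Ts).length = Ts.length := by
  induction Ts with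
  | nil => rfl
  | cons T Ts ih => exact congrArg (· + 1) ih

theorem Inhabited.append {Ts} (h : Inhabited (context Ts)) (ls : List (PTm × PTm))
    (hl : checkLemmas Ts ls = true) : Inhabited (context (ls.map Prod.fst ++ Ts)) := by
  induction ls with
  | nil => exact h
  | cons l ls ih =>
    simp only [checkLemmas, Bool.and_eq_true, length_context] at hl
    exact (ih hl.1.1).cons _ _ hl.1.2 hl.2

namespace PTm

/-! # Notation for the checker -/

/-- An abstraction whose domain is computed from the expected type. -/
def fn (b : PTm → PTm) : PTm := lam unit b

/-- Elimination of the last variable, which is a pair. -/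
def split (b : PTm → PTm → PTm) : PTm := fun d =>
  .sigInd .unit (b (bvar d) (bvar (d + 1)) (d + 2)) (.var 0)

/-- The second projection `Π (p : Σ (x : A), B x), B (fst p)`, applied to `p`. -/
def snd (A : PTm) (B : PTm → PTm) (p : PTm) : PTm := fun d =>
  .sigInd (B (fst A (bvar d)) (d + 1)) (.var 0) (p d)

/-- The first projection, with a motive computed from the type of `p`. -/
def proj₁ (p : PTm) : PTm := fun d => .sigInd .star (.var 1) (p d)

/-- The second projection, with a motive computed from the type of `p`. -/
def proj₂ (p : PTm) : PTm := fun d => .sigInd .star (.var 0) (p d)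

/-- Reflexivity, with the point computed from the expected type. -/
def rfl : PTm := fun _ => .refl .unit

def star : PTm := fun _ => .star

def truncIn (a : PTm) : PTm := fun d => .truncIn (a d)

/-- A path between two points of a truncation, computed from the expected type. -/
def truncPath : PTm := fun _ => .truncPath .unit .unit

/-- Truncation recursion into the expected type. -/
def truncElim (w f t : PTm) : PTm := fun d => .truncRec .star (w d) (f d) (t d)

/-- Generalization over the last variable. -/
def revert (b : PTm) : PTm := fun d => .app (.lam .unit (b (d - 1))) (.var 0)

def truncRec (B w f t : PTm) : PTm := fun d => .truncRec (B d) (w d) (f d) (t d)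

def funextAx (A : PTm) (B : PTm → PTm) (f g : PTm) : PTm := fun d =>
  .funext (A d) (B (bvar d) (d + 1)) (f d) (g d)

def univalenceAx (i : ℕ) (A B : PTm) : PTm := fun d => .univalence i (A d) (B d)

/-- Path induction, with end points computed from the type of `p`. -/
def pathInd (C : PTm → PTm → PTm → PTm) (c : PTm → PTm) (p : PTm) : PTm :=
  idInd C c unit unit p

/-- For `p : x = y` and `q : x = z` in `A`, a path from `y` to `z`. -/
def cancelTm (A z p q : PTm) : PTm :=
  (pathInd (fun x y _ => arrow (id A x z) (id A y z)) (fun _ => fn fun r => r) p).app q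

/-- The universe in which the general lemmas are stated. -/
def V : PTm := univ 1

/-- Mere propositions in `U₀`. -/
def propU : PTm := typesOfHLevel 0 (some 1)

/-- The underlying type of a set or of a mere proposition in `U₀`. -/
def ty (X : PTm) : PTm := fst (univ 0) X

/-- The proof that the underlying type of a set is a set. -/
def tySet (X : PTm) : PTm := snd (univ 0) (isOfHLevel 2) X

/-- The proof that the underlying type of a mere proposition has h-level `1`. -/
def tyProp (X : PTm) : PTm := snd (univ 0) (isOfHLevel 1) X

/-! # Basic homotopy type theory

Every lemma has a type and a proof, and is afterwards available as a variable. -/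

/-- Symmetry and transitivity of paths both follow from this one operation. The general lemmas
quantify over `U₁` so that they apply to `U₀`, `propU` and the type of models and, by cumulativity,
to all types in `U₀`. -/
def cancelT : PTm :=
  pi V fun A => pi A fun x => pi A fun y => pi A fun z =>
  arrow (id A x y) (arrow (id A x z) (id A y z))

def cancelP : PTm :=
  fn fun A => fn fun _ => fn fun _ => fn fun z => fn fun p => fn fun q => cancelTm A z p q

/-- The argument of `bvar` counts binders from the outside, so `bvar n` is the lemma with `n`
predecessors, at whatever depth it is used. The later constants of this kind follow the same
numbering. -/
def cancel : PTm := bvar 0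

def symT : PTm := pi V fun A => pi A fun x => pi A fun y => arrow (id A x y) (id A y x)

def symP : PTm :=
  fn fun A => fn fun x => fn fun y => fn fun p => cancel.apps [A, x, y, x, p, rfl]

def sym : PTm := bvar 1

def transT : PTm :=
  pi V fun A => pi A fun x => pi A fun y => pi A fun z =>
  arrow (id A x y) (arrow (id A y z) (id A x z))

def transP : PTm :=
  fn fun A => fn fun x => fn fun y => fn fun z => fn fun p => fn fun q =>
  cancel.apps [A, y, x, z, sym.apps [A, x, y, p], q]

def trans : PTm := bvar 2

def apT : PTm :=
  pi V fun A => pi V fun B => pi (arrow A B) fun f => pi A fun x => pi A fun y =>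
  arrow (id A x y) (id B (app f x) (app f y))

def apP : PTm :=
  fn fun _ => fn fun B => fn fun f => fn fun _ => fn fun _ => fn fun p =>
  pathInd (fun x y _ => id B (app f x) (app f y)) (fun _ => rfl) p

def ap : PTm := bvar 3

def tranT : PTm :=
  pi V fun A => pi (arrow A V) fun P => pi A fun x => pi A fun y =>
  arrow (id A x y) (arrow (app P x) (app P y))

def tranP : PTm :=
  fn fun _ => fn fun P => fn fun _ => fn fun _ => fn fun p =>
  pathInd (fun x y _ => arrow (app P x) (app P y)) (fun _ => fn fun u => u) p

def tran : PTm := bvar 4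

def funExtT : PTm :=
  pi V fun A => pi (arrow A V) fun B => pi (pi A fun x => app B x) fun f =>
  pi (pi A fun x => app B x) fun g =>
  arrow (pi A fun x => id (app B x) (app f x) (app g x)) (id (pi A fun x => app B x) f g)

def funExtP : PTm :=
  fn fun A => fn fun B => fn fun f => fn fun g => fn fun h =>
  -- The map underlying the right inverse of `happly`; that it is inverse is not needed.
  app (proj₁ (proj₁ (funextAx A (fun x => app B x) f g))) h

def funExt : PTm := bvar 5

/-- Any path from `x` to `y` equals a canonical one, the inverse of `f x x` followed by `f x y`. By
path induction this only has to be seen for the reflexivity path, where it says that a path cancels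
against itself. -/
def propSetT : PTm :=
  pi V fun A => pi (isProp A) fun _ => pi A fun x => pi A fun y =>
  isProp (id A x y)

def propSetP : PTm :=
  fn fun A => fn fun f => fn fun x => fn fun y => fn fun p => fn fun q =>
  -- The term `cancelTm` is used in place of the variable `cancel` because it has to compute on
  -- reflexivity.
  let c : PTm → PTm → PTm := fun x y => cancelTm A y (f.apps [x, x]) (f.apps [x, y])
  let h : PTm → PTm := fun p => pathInd (fun x y p => id (id A x y) (c x y) p)
    (fun x => pathInd (fun _ y p => id (id A y y) (cancelTm A y p p) (refl y)) (fun _ => rfl)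
      (f.apps [x, x])) p
  cancel.apps [id A x y, c x y, p, q, h p, h q]

def propSet : PTm := bvar 6

def propPiT : PTm :=
  pi V fun A => pi (arrow A V) fun B => pi (pi A fun x => isProp (app B x)) fun _ =>
  isProp (pi A fun x => app B x)

def propPiP : PTm :=
  fn fun A => fn fun B => fn fun h => fn fun f => fn fun g =>
  funExt.apps [A, B, f, g, fn fun x => h.apps [x, app f x, app g x]]

def propPi : PTm := bvar 7

def propProdT : PTm :=
  pi V fun A => pi V fun B => arrow (isProp A) (arrow (isProp B) (isProp (prod A B)))

def propProdP : PTm :=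
  fn fun A => fn fun B => fn fun f => fn fun g => fn fun _ => split fun a b => fn fun _ =>
  split fun a' b' =>
  pathInd (fun a a' _ => id (prod A B) (pair a b) (pair a' b')) (fun a =>
    pathInd (fun b b' _ => id (prod A B) (pair a b) (pair a b')) (fun _ => rfl)
      (g.apps [b, b'])) (f.apps [a, a'])

def propProd : PTm := bvar 8

/-- Elements of a family of mere propositions do not matter for the equality of pairs. -/
def pairEqT : PTm :=
  pi V fun X => pi (arrow X V) fun P => pi (pi X fun x => isProp (app P x)) fun _ =>
  pi X fun x => pi X fun x' => pi (id X x x') fun _ => pi (app P x) fun u =>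
  pi (app P x') fun u' => id (sig X fun x => app P x) (pair x u) (pair x' u')

def pairEqP : PTm :=
  fn fun X => fn fun P => fn fun h => fn fun _ => fn fun _ => fn fun p =>
  let S : PTm := sig X fun x => app P x
  pathInd (fun x x' _ => pi (app P x) fun u => pi (app P x') fun u' =>
    id S (pair x u) (pair x' u'))
    (fun x => fn fun u => fn fun u' =>
      pathInd (fun u u' _ => id S (pair x u) (pair x u')) (fun _ => rfl) (h.apps [x, u, u'])) p

def pairEq : PTm := bvar 9

/-- Used for the two relations of a model followed by its axioms. The types of the relations do not
depend on each other, so the two paths combine without transport. -/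
def tripleEqT : PTm :=
  pi V fun X => pi V fun Y => pi (arrow X (arrow Y V)) fun P =>
  pi (pi X fun x => pi Y fun y => isProp (P.apps [x, y])) fun _ =>
  pi X fun x => pi X fun x' => pi (id X x x') fun _ =>
  pi Y fun y => pi Y fun y' => pi (id Y y y') fun _ =>
  pi (P.apps [x, y]) fun u => pi (P.apps [x', y']) fun u' =>
  id (sig X fun x => sig Y fun y => P.apps [x, y]) (pair x (pair y u)) (pair x' (pair y' u'))

def tripleEqP : PTm :=
  fn fun X => fn fun Y => fn fun P => fn fun h => fn fun _ => fn fun _ => fn fun p =>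
  fn fun y => fn fun y' => fn fun q => fn fun u => fn fun u' =>
  let S : PTm := sig X fun x => sig Y fun y => P.apps [x, y]
  let S' : PTm → PTm := fun x => sig Y fun y => P.apps [x, y]
  (pathInd (fun x x' _ => pi (P.apps [x, y]) fun u => pi (P.apps [x', y']) fun u' =>
    id S (pair x (pair y u)) (pair x' (pair y' u')))
    (fun x => fn fun u => fn fun u' =>
      ap.apps [S' x, S, fn fun w => pair x w, pair y u, pair y' u',
        pairEq.apps [Y, fn fun y => P.apps [x, y], fn fun y => h.apps [x, y], y, y', q, u, u']])
    p).apps [u, u']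

def tripleEq : PTm := bvar 10

/-- H-level `1` asks for contractible path types: the center is the given path, and the contraction
is `propSet`. -/
def propLevelT : PTm := pi V fun A => arrow (isProp A) (isOfHLevel 1 A)

def propLevelP : PTm :=
  fn fun A => fn fun f => fn fun x => fn fun y =>
  pair (f.apps [x, y]) (fn fun q => propSet.apps [A, f, x, y, f.apps [x, y], q])

def propLevel : PTm := bvar 11

def levelPropT : PTm := pi V fun A => arrow (isOfHLevel 1 A) (isProp A)

def levelPropP : PTm := fn fun _ => fn fun h => fn fun x => fn fun y => proj₁ (h.apps [x, y])

def levelProp : PTm := bvar 12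

def setPathT : PTm :=
  pi V fun A => arrow (isOfHLevel 2 A) (pi A fun x => pi A fun y => isProp (id A x y))

def setPathP : PTm :=
  fn fun A => fn fun h => fn fun x => fn fun y => levelProp.apps [id A x y, h.apps [x, y]]

def setPath : PTm := bvar 13

def propContrT : PTm := pi V fun A => arrow (isProp A) (isProp (isContr A))

def propContrP : PTm :=
  fn fun A => fn fun f => fn fun _ => split fun a h => fn fun _ => split fun a' h' =>
  pairEq.apps [A, fn fun x => pi A fun y => id A x y,
    fn fun x => propPi.apps [A, fn fun y => id A x y, fn fun y => propSet.apps [A, f, x, y]],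
    a, a', f.apps [a, a'], h, h']

def propContr : PTm := bvar 14

/-- To show that a type has at most one element, one may assume an element of it. Here this makes
`A` a mere proposition, hence a set, so that contractibility of its path types is a mere
proposition. -/
def propHLevelT : PTm := pi V fun A => isProp (isOfHLevel 1 A)

def propHLevelP : PTm :=
  fn fun A => fn fun h => 
  app (propPi.apps [A, fn fun x => pi A fun y => isContr (id A x y), fn fun x =>
    propPi.apps [A, fn fun y => isContr (id A x y), fn fun y =>
      propContr.apps [id A x y, propSet.apps [A, levelProp.apps [A, h], x, y]]]]) h

def propHLevel : PTm := bvar 15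

/-- Propositional extensionality. -/
def propExtT : PTm :=
  pi (univ 0) fun X => pi (univ 0) fun Y => arrow (isProp X) (arrow (isProp Y)
    (arrow (arrow X Y) (arrow (arrow Y X) (id (univ 0) X Y))))

def propExtP : PTm :=
  fn fun X => fn fun Y => fn fun hX => fn fun hY => fn fun f => fn fun g =>
  -- The inverse of `idToEquiv`, applied to the equivalence formed by `f` and `g`; the homotopies
  -- are automatic in mere propositions.
  app (proj₁ (proj₁ (univalenceAx 0 X Y)))
    (pair f (pair
      (pair g (fn fun y => hY.apps [app f (app g y), y]))
      (pair g (fn fun x => hX.apps [app g (app f x), x]))))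

def propExt : PTm := bvar 16

/-- For types bundled with their h-level: by `propHLevel` the second components do not matter, so
propositional extensionality suffices. -/
def hpropEqT : PTm :=
  pi (univ 0) fun X => pi (isOfHLevel 1 X) fun h => pi propU fun Q =>
  arrow (arrow X (ty Q)) (arrow (arrow (ty Q) X) (id propU (pair X h) Q))

def hpropEqP : PTm :=
  fn fun X => fn fun h => fn fun _ => split fun Y h' => fn fun f => fn fun g =>
  pairEq.apps [univ 0, fn fun X => isOfHLevel 1 X, fn fun X => app propHLevel X, X, Y,
    propExt.apps [X, Y, levelProp.apps [X, h], levelProp.apps [Y, h'], f, g], h, h']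

def hpropEq : PTm := bvar 17

def pathLevel (X x y : PTm) : PTm :=
  propLevel.apps [id (ty X) x y, setPath.apps [ty X, tySet X, x, y]]

/-- The mere proposition `x = y` for elements of a set `X`. -/
def pathProp (X x y : PTm) : PTm := pair (id (ty X) x y) (pathLevel X x y)

/-- A predicate on a set that holds exactly at `x` is the predicate `x = -`. -/
def singletonT : PTm :=
  pi (setU 0) fun X => pi (ty X) fun x => pi (arrow (ty X) propU) fun Q =>
  arrow (ty (app Q x)) (arrow (pi (ty X) fun y => arrow (ty (app Q y)) (id (ty X) x y))
    (pi (ty X) fun y => id propU (pathProp X x y) (app Q y)))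

def singletonP : PTm :=
  fn fun X => fn fun x => fn fun Q => fn fun q => fn fun u => fn fun y =>
  hpropEq.apps [id (ty X) x y, pathLevel X x y, app Q y,
    fn fun p => tran.apps [ty X, fn fun z => ty (app Q z), x, y, p, q],
    app u y]

def singleton : PTm := bvar 18

end PTm

open PTm

/-- The lemmas above, the last one first. -/
def basics : List (PTm × PTm) :=
  [(singletonT, singletonP), (hpropEqT, hpropEqP), (propExtT, propExtP),
   (propHLevelT, propHLevelP), (propContrT, propContrP), (setPathT, setPathP),
   (levelPropT, levelPropP), (propLevelT, propLevelP), (tripleEqT, tripleEqP),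
   (pairEqT, pairEqP), (propProdT, propProdP), (propPiT, propPiP),
   (propSetT, propSetP), (funExtT, funExtP), (tranT, tranP),
   (apT, apP), (transT, transP), (symT, symP),
   (cancelT, cancelP)]

/-- The kernel evaluates the checker on all the lemmas; the soundness theorem turns the result into
derivations. -/
theorem inhabited_basics : Inhabited (context (basics.map Prod.fst ++ [])) :=
  Inhabited.append (Ts := []) .nil basics (by decide +kernel)

end HoTT

namespace HoTT.PTm

/-! # Strict categories and models -/

/-- Iterated `Π`-types over mere propositions, with a proof that the final type `T` is a mere
proposition. -/
inductive Tele : Type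
  | nil (T h : PTm)
  | cons (A : PTm) (B : PTm → Tele)

namespace Tele

def toPi : Tele → PTm
  | nil T _ => T
  | cons A B => pi A fun x => (B x).toPi

def toProp : Tele → PTm
  | nil _ h => h
  | cons A B => propPi.apps [A, fn fun x => (B x).toPi, fn fun x => (B x).toProp]

end Tele

def setT : PTm := setU 0

/-- Arrows from `x` to `y`. -/
def ar (A x y : PTm) : PTm := ty (A.apps [x, y])

def idn (I x f : PTm) : PTm := ty (I.apps [x, f])

def cmp (K x y z f g h : PTm) : PTm := ty (K.apps [x, y, z, f, g, h])

/-- The formula that the mere proposition `P` holds. -/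
def inh (P : PTm) : PTm := trunc (sig P fun _ => unit)

def arT (O : PTm) : PTm := arrow (ty O) (arrow (ty O) setT)

def idnT (O A : PTm) : PTm := pi (ty O) fun x => arrow (ar A x x) propU

def cmpT (O A : PTm) : PTm :=
  pi (ty O) fun x => pi (ty O) fun y => pi (ty O) fun z =>
  arrow (ar A x y) (arrow (ar A y z) (arrow (ar A x z) propU))

def inhTele (P : PTm) : Tele := .nil (inh P) (fn fun _ => fn fun _ => truncPath)

/-- For this axiom and the following ones, `toPi` has to be literally the interpretation of the
formula of the theory, since the two are later compared as terms. The telescope also yields, by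
iterating `propPi`, a proof that the axiom is a mere proposition. -/
def ax₁ (O A I : PTm) : Tele :=
  .cons (ty O) fun x => .nil (trunc (sig (ar A x x) fun i => inh (idn I x i)))
    (fn fun _ => fn fun _ => truncPath)

def ax₂ (O A K : PTm) : Tele :=
  .cons (ty O) fun x => .cons (ty O) fun y => .cons (ty O) fun z =>
  .cons (ar A x y) fun f => .cons (ar A y z) fun g =>
  .nil (trunc (sig (ar A x z) fun h => inh (cmp K x y z f g h)))
    (fn fun _ => fn fun _ => truncPath)

def ax₃ (O A K : PTm) : Tele :=
  .cons (ty O) fun x => .cons (ty O) fun y => .cons (ty O) fun z =>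
  .cons (ar A x y) fun f => .cons (ar A y z) fun g => .cons (ar A x z) fun h =>
  .cons (ar A x z) fun h' => .cons (cmp K x y z f g h) fun _ =>
  .cons (cmp K x y z f g h') fun _ => inhTele (id (ar A x z) h h')

def ax₄ (O A K : PTm) : Tele :=
  .cons (ty O) fun x => .cons (ty O) fun y => .cons (ty O) fun z => .cons (ty O) fun w =>
  .cons (ar A x y) fun f => .cons (ar A y z) fun g => .cons (ar A z w) fun h =>
  .cons (ar A x z) fun i => .cons (ar A x w) fun j => .cons (ar A y w) fun k =>
  .cons (cmp K x y z f g i) fun _ => .cons (cmp K x z w i h j) fun _ =>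
  .cons (cmp K y z w g h k) fun _ => inhTele (cmp K x y w f k j)

def ax₅ (O A I : PTm) : Tele :=
  .cons (ty O) fun x => .cons (ar A x x) fun i => .cons (ar A x x) fun j =>
  .cons (idn I x i) fun _ => .cons (idn I x j) fun _ => inhTele (id (ar A x x) i j)

def ax₆ (O A I K : PTm) : Tele :=
  .cons (ty O) fun x => .cons (ty O) fun y => .cons (ar A x x) fun i =>
  .cons (ar A x y) fun g => .cons (idn I x i) fun _ => inhTele (cmp K x x y i g g)

def ax₇ (O A I K : PTm) : Tele :=
  .cons (ty O) fun x => .cons (ty O) fun y => .cons (ar A y y) fun i =>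
  .cons (ar A x y) fun f => .cons (idn I y i) fun _ => inhTele (cmp K x y y f i f)

/-- The axioms that do not assert existence. -/
def restT (O A I K : PTm) : PTm :=
  prod (ax₃ O A K).toPi <| prod (ax₄ O A K).toPi <| prod (ax₅ O A I).toPi <|
    prod (ax₆ O A I K).toPi (ax₇ O A I K).toPi

def axT (O A I K : PTm) : PTm :=
  prod (ax₁ O A I).toPi <| prod (ax₂ O A K).toPi (restT O A I K)

/-- Models of the theory of strict categories. -/
def modT : PTm :=
  sig setT fun O => sig (arT O) fun A => sig (idnT O A) fun I => sig (cmpT O A) fun K =>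
  axT O A I K

def unitT (O A : PTm) : PTm := pi (ty O) fun x => ar A x x

def mulT (O A : PTm) : PTm :=
  pi (ty O) fun x => pi (ty O) fun y => pi (ty O) fun z =>
  arrow (ar A x y) (arrow (ar A y z) (ar A x z))

def hset (X x y : PTm) : PTm := setPath.apps [ty X, tySet X, x, y]

def assocTele (O A : PTm) (c : PTm → PTm → PTm → PTm → PTm → PTm) : Tele :=
  .cons (ty O) fun x => .cons (ty O) fun y => .cons (ty O) fun z => .cons (ty O) fun w =>
  .cons (ar A x y) fun f => .cons (ar A y z) fun g => .cons (ar A z w) fun h =>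
  let a := c x z w (c x y z f g) h
  let b := c x y w f (c y z w g h)
  .nil (id (ar A x w) a b) (hset (A.apps [x, w]) a b)

def unitTele (O A : PTm) (e : PTm → PTm) (c : PTm → PTm → PTm → PTm → PTm → PTm) : Tele :=
  .cons (ty O) fun x => .cons (ty O) fun y => .cons (ar A x y) fun f =>
  let a := c x x y (e x) f
  let b := c x y y f (e y)
  .nil (prod (id (ar A x y) a f) (id (ar A x y) b f))
    (propProd.apps [id (ar A x y) a f, id (ar A x y) b f, hset (A.apps [x, y]) a f,
      hset (A.apps [x, y]) b f])

/-- The laws of a category. -/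
def lawsOf (O A : PTm) (e : PTm → PTm) (c : PTm → PTm → PTm → PTm → PTm → PTm) : PTm :=
  prod (assocTele O A c).toPi (unitTele O A e c).toPi

/-- Chosen identities. -/
def idnSigT (O A I : PTm) : PTm := pi (ty O) fun x => sig (ar A x x) fun i => idn I x i

/-- Chosen composites. -/
def cmpSigT (O A K : PTm) : PTm :=
  pi (ty O) fun x => pi (ty O) fun y => pi (ty O) fun z =>
  pi (ar A x y) fun f => pi (ar A y z) fun g => sig (ar A x z) fun h => cmp K x y z f g h

/-! # Lemmas on strict categories and models -/

/-- The atomic conclusions of the axioms appear in the form `inh P`; for a mere proposition `P`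
nothing is lost. -/
def untruncT : PTm := pi V fun P => arrow (isProp P) (arrow (inh P) P)

def untruncP : PTm :=
  fn fun _ => fn fun h => fn fun t => truncElim h (fn fun s => proj₁ s) t

def untrunc : PTm := bvar 19

/-- This is what allows leaving the truncation in the existence axioms: truncation recursion only
maps into mere propositions, and a uniqueness statement makes the type of solutions one. -/
def uniqueT : PTm :=
  pi V fun X => pi (arrow X V) fun Q => arrow (pi X fun x => isProp (app Q x))
    (arrow (pi X fun x => pi X fun y => arrow (app Q x) (arrow (app Q y) (id X x y)))
      (isProp (sig X fun x => app Q x)))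

def uniqueP : PTm :=
  fn fun X => fn fun Q => fn fun h => fn fun u =>
  fn fun _ => split fun x q => fn fun _ => split fun y r =>
  pairEq.apps [X, Q, h, x, y, u.apps [x, y, q, r], q, r]

def unique : PTm := bvar 20

/-- Quantification over the data of a model. -/
def modelPi (B : PTm → PTm → PTm → PTm → PTm → PTm) : PTm :=
  pi setT fun O => pi (arT O) fun A => pi (idnT O A) fun I => pi (cmpT O A) fun K =>
  pi (restT O A I K) fun R => B O A I K R

def modelFn (B : PTm → PTm → PTm → PTm → PTm → PTm) : PTm :=
  fn fun O => fn fun A => fn fun I => fn fun K => fn fun R => B O A I K R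

/-- Uniqueness of composites. -/
def cmpEqT : PTm := modelPi fun O A _ K _ =>
  pi (ty O) fun x => pi (ty O) fun y => pi (ty O) fun z => pi (ar A x y) fun f =>
  pi (ar A y z) fun g => pi (ar A x z) fun h => pi (ar A x z) fun h' =>
  arrow (cmp K x y z f g h) (arrow (cmp K x y z f g h') (id (ar A x z) h h'))

def cmpEqP : PTm := modelFn fun _ A _ _ R =>
  fn fun x => fn fun y => fn fun z => fn fun f => fn fun g => fn fun h => fn fun h' =>
  fn fun τ => fn fun τ' => untrunc.apps [id (ar A x z) h h', hset (A.apps [x, z]) h h',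
    (proj₁ R).apps [x, y, z, f, g, h, h', τ, τ']]

def cmpEq : PTm := bvar 21

/-- Uniqueness of identities. -/
def idnEqT : PTm := modelPi fun O A I _ _ =>
  pi (ty O) fun x => pi (ar A x x) fun i => pi (ar A x x) fun j =>
  arrow (idn I x i) (arrow (idn I x j) (id (ar A x x) i j))

def idnEqP : PTm := modelFn fun _ A _ _ R =>
  fn fun x => fn fun i => fn fun j => fn fun σ => fn fun σ' =>
  untrunc.apps [id (ar A x x) i j, hset (A.apps [x, x]) i j,
    (proj₁ (proj₂ (proj₂ R))).apps [x, i, j, σ, σ']]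

def idnEq : PTm := bvar 22

def idnUniqueT : PTm := modelPi fun O A I _ _ =>
  pi (ty O) fun x => isProp (sig (ar A x x) fun i => idn I x i)

def idnUniqueP : PTm := modelFn fun O A I K R => fn fun x =>
  unique.apps [ar A x x, fn fun i => idn I x i,
    fn fun i => levelProp.apps [idn I x i, tyProp (I.apps [x, i])],
    idnEq.apps [O, A, I, K, R, x]]

def idnUnique : PTm := bvar 23

def cmpUniqueT : PTm := modelPi fun O A _ K _ =>
  pi (ty O) fun x => pi (ty O) fun y => pi (ty O) fun z => pi (ar A x y) fun f =>
  pi (ar A y z) fun g => isProp (sig (ar A x z) fun h => cmp K x y z f g h)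

def cmpUniqueP : PTm := modelFn fun O A I K R =>
  fn fun x => fn fun y => fn fun z => fn fun f => fn fun g =>
  unique.apps [ar A x z, fn fun h => cmp K x y z f g h,
    fn fun h => levelProp.apps [cmp K x y z f g h, tyProp (K.apps [x, y, z, f, g, h])],
    cmpEq.apps [O, A, I, K, R, x, y, z, f, g]]

def cmpUnique : PTm := bvar 24

def axPropT : PTm :=
  pi setT fun O => pi (arT O) fun A => pi (idnT O A) fun I => pi (cmpT O A) fun K =>
  isProp (axT O A I K)

def axPropP : PTm :=
  fn fun O => fn fun A => fn fun I => fn fun K =>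
  -- Types are carried along with proofs that they are mere propositions: `p` forms products and `q`
  -- enters with a telescope.
  let p (T : PTm × PTm) (S : PTm × PTm) : PTm × PTm :=
    (prod T.1 S.1, propProd.apps [T.1, S.1, T.2, S.2])
  let q (T : Tele) : PTm × PTm := (T.toPi, T.toProp)
  (p (q (ax₁ O A I)) <| p (q (ax₂ O A K)) <| p (q (ax₃ O A K)) <| p (q (ax₄ O A K)) <|
    p (q (ax₅ O A I)) <| p (q (ax₆ O A I K)) (q (ax₇ O A I K))).2

def axProp : PTm := bvar 25

def lawsPropT : PTm :=
  pi setT fun O => pi (arT O) fun A => pi (unitT O A) fun e => pi (mulT O A) fun c =>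
  isProp (lawsOf O A (fun x => app e x) fun x y z f g => c.apps [x, y, z, f, g])

def lawsPropP : PTm :=
  fn fun O => fn fun A => fn fun e => fn fun c =>
  let a := assocTele O A fun x y z f g => c.apps [x, y, z, f, g]
  let u := unitTele O A (fun x => app e x) fun x y z f g => c.apps [x, y, z, f, g]
  propProd.apps [a.toPi, u.toPi, a.toProp, u.toProp]

def lawsProp : PTm := bvar 26

/-- The laws of a category hold for chosen identities and composites. -/
def lawsT : PTm := modelPi fun O A I K _ =>
  pi (idnSigT O A I) fun ε => pi (cmpSigT O A K) fun κ =>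
  lawsOf O A (fun x => fst (ar A x x) (app ε x))
    fun x y z f g => fst (ar A x z) (κ.apps [x, y, z, f, g])

/-- Here `u` turns a truncated proof that `h` is a composite of `f` and `g` into a path from the
chosen composite to `h`. Axiom 4, applied to the chosen composites, says that `(fg)h` is a composite
of `f` and `gh`, so uniqueness gives associativity; axioms 6 and 7 give the unit laws in the same
way. -/
def lawsP : PTm := modelFn fun O A I K R => fn fun ε => fn fun κ =>
  let e : PTm → PTm := fun x => fst (ar A x x) (app ε x)
  let c : PTm → PTm → PTm → PTm → PTm → PTm :=
    fun x y z f g => fst (ar A x z) (κ.apps [x, y, z, f, g])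
  let τ : PTm → PTm → PTm → PTm → PTm → PTm := fun x y z f g => proj₂ (κ.apps [x, y, z, f, g])
  let u : PTm → PTm → PTm → PTm → PTm → PTm → PTm → PTm := fun x y z f g h t =>
    cmpEq.apps [O, A, I, K, R, x, y, z, f, g, c x y z f g, h, τ x y z f g,
      untrunc.apps [cmp K x y z f g h,
        levelProp.apps [cmp K x y z f g h, tyProp (K.apps [x, y, z, f, g, h])], t]]
  -- The pair of axioms 6 and 7, as `R` begins with axiom 3.
  let S : PTm := proj₂ (proj₂ (proj₂ R))
  pair
    (fn fun x => fn fun y => fn fun z => fn fun w => fn fun f => fn fun g => fn fun h =>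
      let i := c x y z f g
      let j := c x z w i h
      let k := c y z w g h
      sym.apps [ar A x w, c x y w f k, j, u x y w f k j ((proj₁ (proj₂ R)).apps
        [x, y, z, w, f, g, h, i, j, k, τ x y z f g, τ x z w i h, τ y z w g h])])
    (fn fun x => fn fun y => fn fun f => pair
      (u x x y (e x) f f ((proj₁ S).apps [x, y, e x, f, proj₂ (app ε x)]))
      (u x y y f (e y) f ((proj₂ S).apps [x, y, e y, f, proj₂ (app ε y)])))

def laws : PTm := bvar 27

/-- The relation of being an identity, in a category. -/
def idnRel (A : PTm) (e : PTm → PTm) (x f : PTm) : PTm := pathProp (A.apps [x, x]) (e x) f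

/-- The relation of being a composite, in a category. -/
def cmpRel (A : PTm) (c : PTm → PTm → PTm → PTm → PTm → PTm) (x y z f g h : PTm) : PTm :=
  pathProp (A.apps [x, z]) (c x y z f g) h

/-- This version and `cmpRelLam` carry explicit domains because they occur in statements, which
`checkType` requires to be unchanged by elaboration. The versions built with `fn` serve inside
proofs. -/
def idnRelLam (O A : PTm) (e : PTm → PTm) : PTm :=
  lam (ty O) fun x => lam (ar A x x) fun f => idnRel A e x f

def cmpRelLam (O A : PTm) (c : PTm → PTm → PTm → PTm → PTm → PTm) : PTm :=
  lam (ty O) fun x => lam (ty O) fun y => lam (ty O) fun z => lam (ar A x y) fun f =>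
  lam (ar A y z) fun g => lam (ar A x z) fun h => cmpRel A c x y z f g h

/-- For graph relations the axioms are path algebra. In axioms 3 and 5, two paths with a common
source are cancelled. In axiom 4, `(fg)h` is joined to `fk` by associativity and to `j` by the
hypotheses. In axioms 6 and 7, the identity in a unit law is replaced along a path. -/
def restLemmaT : PTm :=
  pi setT fun O => pi (arT O) fun A => pi (unitT O A) fun e => pi (mulT O A) fun c =>
  let c' : PTm → PTm → PTm → PTm → PTm → PTm := fun x y z f g => c.apps [x, y, z, f, g]
  pi (lawsOf O A (app e) c') fun _ =>
  restT O A (idnRelLam O A (app e)) (cmpRelLam O A c')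

def restLemmaP : PTm :=
  fn fun _ => fn fun A => fn fun e => fn fun c' => fn fun l =>
  let c : PTm → PTm → PTm → PTm → PTm → PTm := fun x y z f g => c'.apps [x, y, z, f, g]
  let ret (p : PTm) : PTm := truncIn (pair p star)
  pair (fn fun x => fn fun y => fn fun z => fn fun f => fn fun g => fn fun h => fn fun h' =>
    fn fun τ => fn fun τ' => ret (cancel.apps [ar A x z, c x y z f g, h, h', τ, τ'])) <|
  pair (fn fun x => fn fun y => fn fun z => fn fun w => fn fun f => fn fun g => fn fun h =>
    fn fun i => fn fun j => fn fun k => fn fun τ₁ => fn fun τ₂ => fn fun τ₃ =>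
    let a := c x z w (c x y z f g) h
    ret (cancel.apps [ar A x w, a, c x y w f k, j,
      trans.apps [ar A x w, a, c x y w f (c y z w g h), c x y w f k,
        (proj₁ l).apps [x, y, z, w, f, g, h],
        ap.apps [ar A y w, ar A x w, fn fun k => c x y w f k, c y z w g h, k, τ₃]],
      trans.apps [ar A x w, a, c x z w i h, j,
        ap.apps [ar A x z, ar A x w, fn fun i => c x z w i h, c x y z f g, i, τ₁], τ₂]])) <|
  pair (fn fun x => fn fun i => fn fun j => fn fun σ => fn fun σ' =>
    ret (cancel.apps [ar A x x, app e x, i, j, σ, σ'])) <|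
  pair (fn fun x => fn fun y => fn fun i => fn fun g => fn fun σ =>
    ret (cancel.apps [ar A x y, c x x y (app e x) g, c x x y i g, g,
      ap.apps [ar A x x, ar A x y, fn fun i => c x x y i g, app e x, i, σ],
      proj₁ ((proj₂ l).apps [x, y, g])]))
  (fn fun x => fn fun y => fn fun i => fn fun f => fn fun σ =>
    ret (cancel.apps [ar A x y, c x y y f (app e y), c x y y f i, f,
      ap.apps [ar A y y, ar A x y, fn fun i => c x y y f i, app e y, i, σ],
      proj₂ ((proj₂ l).apps [x, y, f])]))

def restLemma : PTm := bvar 28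

def idnRelEqT : PTm := modelPi fun O A I _ _ => pi (idnSigT O A I) fun ε =>
  id (idnT O A) (idnRelLam O A fun x => fst (ar A x x) (app ε x)) I

/-- After function extensionality in both arguments this is `singleton`: the chosen identity
satisfies `I`, and by axiom 5 it equals anything that does. Composites are treated in the same way,
with six arguments and axiom 3. -/
def idnRelEqP : PTm := modelFn fun O A I K R => fn fun ε =>
  let e : PTm → PTm := fun x => fst (ar A x x) (app ε x)
  funExt.apps [ty O, fn fun x => arrow (ar A x x) propU,
    fn fun x => fn fun f => idnRel A e x f, I, fn fun x =>
  funExt.apps [ar A x x, fn fun _ => propU, fn fun f => idnRel A e x f, app I x,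
    singleton.apps [A.apps [x, x], e x, app I x, proj₂ (app ε x), fn fun i => fn fun σ =>
      idnEq.apps [O, A, I, K, R, x, e x, i, proj₂ (app ε x), σ]]]]

def idnRelEq : PTm := bvar 29

def cmpRelEqT : PTm := modelPi fun O A _ K _ => pi (cmpSigT O A K) fun κ =>
  id (cmpT O A) (cmpRelLam O A fun x y z f g => fst (ar A x z) (κ.apps [x, y, z, f, g])) K

def cmpRelEqP : PTm := modelFn fun O A I K R => fn fun κ =>
  let c : PTm → PTm → PTm → PTm → PTm → PTm :=
    fun x y z f g => fst (ar A x z) (κ.apps [x, y, z, f, g])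
  let r := cmpRel A c
  funExt.apps [ty O, fn fun x => pi (ty O) fun y => pi (ty O) fun z =>
      arrow (ar A x y) (arrow (ar A y z) (arrow (ar A x z) propU)),
    fn fun x => fn fun y => fn fun z => fn fun f => fn fun g => fn fun h => r x y z f g h,
    K, fn fun x =>
  funExt.apps [ty O, fn fun y => pi (ty O) fun z =>
      arrow (ar A x y) (arrow (ar A y z) (arrow (ar A x z) propU)),
    fn fun y => fn fun z => fn fun f => fn fun g => fn fun h => r x y z f g h,
    app K x, fn fun y =>
  funExt.apps [ty O, fn fun z => arrow (ar A x y) (arrow (ar A y z) (arrow (ar A x z) propU)),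
    fn fun z => fn fun f => fn fun g => fn fun h => r x y z f g h,
    K.apps [x, y], fn fun z =>
  funExt.apps [ar A x y, fn fun _ => arrow (ar A y z) (arrow (ar A x z) propU),
    fn fun f => fn fun g => fn fun h => r x y z f g h, K.apps [x, y, z], fn fun f =>
  funExt.apps [ar A y z, fn fun _ => arrow (ar A x z) propU,
    fn fun g => fn fun h => r x y z f g h, K.apps [x, y, z, f], fn fun g =>
  funExt.apps [ar A x z, fn fun _ => propU, fn fun h => r x y z f g h,
    K.apps [x, y, z, f, g],
    singleton.apps [A.apps [x, z], c x y z f g, K.apps [x, y, z, f, g],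
      proj₂ (κ.apps [x, y, z, f, g]), fn fun h => fn fun τ =>
      cmpEq.apps [O, A, I, K, R, x, y, z, f, g, c x y z f g, h,
        proj₂ (κ.apps [x, y, z, f, g]), τ]]]]]]]]

def cmpRelEq : PTm := bvar 30

/-- Models with given identities and composites are equal. -/
def modelPathT : PTm :=
  pi setT fun O => pi (arT O) fun A => pi (idnT O A) fun I => pi (cmpT O A) fun K =>
  pi (axT O A I K) fun a => pi (restT O A I K) fun _ =>
  pi (idnSigT O A I) fun ε => pi (cmpSigT O A K) fun κ =>
  let I' := idnRelLam O A fun x => fst (ar A x x) (app ε x)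
  let K' := cmpRelLam O A fun x y z f g => fst (ar A x z) (κ.apps [x, y, z, f, g])
  pi (axT O A I' K') fun a' => id modT (pair O <| pair A <| pair I' <| pair K' a')
    (pair O <| pair A <| pair I <| pair K a)

def modelPathP : PTm :=
  fn fun O => fn fun A => fn fun I => fn fun K => fn fun a => fn fun R => fn fun ε =>
  fn fun κ => fn fun a' =>
  let I' := idnRelLam O A fun x => fst (ar A x x) (app ε x)
  let K' := cmpRelLam O A fun x y z f g => fst (ar A x z) (κ.apps [x, y, z, f, g])
  -- Objects and arrows coincide, so only the relations have to be compared; the proof `a'` may be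
  -- arbitrary by `axProp`.
  ap.apps [sig (idnT O A) fun I => sig (cmpT O A) fun K => axT O A I K, modT,
    fn fun w => pair O (pair A w), pair I' (pair K' a'), pair I (pair K a),
    tripleEq.apps [idnT O A, cmpT O A, fn fun I => fn fun K => axT O A I K,
      fn fun I => fn fun K => axProp.apps [O, A, I, K],
      I', I, idnRelEq.apps [O, A, I, K, R, ε], K', K, cmpRelEq.apps [O, A, I, K, R, κ], a', a]]

def modelPath : PTm := bvar 31

/-! # The equivalence -/

/-- The witness in an existence axiom for a graph relation: the chosen element is related to itself
by reflexivity. -/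
def returnPath (i : PTm) : PTm := truncIn (pair i (truncIn (pair rfl star)))

/-- The model associated with a strict category. -/
def modelAx (O A : PTm) (e : PTm → PTm) (c : PTm → PTm → PTm → PTm → PTm → PTm) (l : PTm) :
    PTm :=
  pair (fn fun x => returnPath (e x)) <|
  pair (fn fun x => fn fun y => fn fun z => fn fun f => fn fun g => returnPath (c x y z f g))
    (restLemma.apps [O, A, fn e,
      fn fun x => fn fun y => fn fun z => fn fun f => fn fun g => c x y z f g, l])

def idnRelFn (A : PTm) (e : PTm → PTm) : PTm := fn fun x => fn fun f => idnRel A e x f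

def cmpRelFn (A : PTm) (c : PTm → PTm → PTm → PTm → PTm → PTm) : PTm :=
  fn fun x => fn fun y => fn fun z => fn fun f => fn fun g => fn fun h =>
  cmpRel A c x y z f g h

def toModel : PTm :=
  -- The proof that the objects form a set depends on the precategory. Generalizing over it makes
  -- the precategory the last variable, which can then be split.
  fn fun _ => split fun _ _ => revert <| split fun C _ => split fun H _ => split fun e _ =>
  split fun c l => fn fun hC =>
  let c' : PTm → PTm → PTm → PTm → PTm → PTm := fun x y z f g => c.apps [x, y, z, f, g]
  pair (pair C hC) <| pair H <| pair (idnRelFn H (app e)) <| pair (cmpRelFn H c')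
    (modelAx (pair C hC) H (app e) c' l)

/-- The chosen identity of `x`. -/
def idnSig (O A I K R a x : PTm) : PTm :=
  truncRec (sig (ar A x x) fun i => idn I x i) (idnUnique.apps [O, A, I, K, R, x])
    (fn fun s => pair (proj₁ s) (untrunc.apps [idn I x (proj₁ s),
      levelProp.apps [idn I x (proj₁ s), tyProp (I.apps [x, proj₁ s])], proj₂ s]))
    (app a x)

/-- The chosen composite of `f` and `g`. -/
def cmpSig (O A I K R a x y z f g : PTm) : PTm :=
  truncRec (sig (ar A x z) fun h => cmp K x y z f g h)
    (cmpUnique.apps [O, A, I, K, R, x, y, z, f, g])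
    (fn fun s => pair (proj₁ s) (untrunc.apps [cmp K x y z f g (proj₁ s),
      levelProp.apps [cmp K x y z f g (proj₁ s), tyProp (K.apps [x, y, z, f, g, proj₁ s])],
      proj₂ s]))
    (a.apps [x, y, z, f, g])

def lawsTm (O A I K R : PTm) (ε : PTm → PTm) (κ : PTm → PTm → PTm → PTm → PTm → PTm) : PTm :=
  laws.apps [O, A, I, K, R, fn ε,
    fn fun x => fn fun y => fn fun z => fn fun f => fn fun g => κ x y z f g]

/-- Applied to the model of a category, the truncation recursions meet explicit witnesses and
compute, so the original identities and composites return up to conversion. -/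
def ofModel : PTm :=
  fn fun _ => split fun O _ => split fun A _ => split fun I _ => split fun K _ =>
  split fun a _ => split fun b R =>
  let ε : PTm → PTm := idnSig O A I K R a
  let κ : PTm → PTm → PTm → PTm → PTm → PTm := cmpSig O A I K R b
  pair (pair (ty O) <| pair A <| pair (fn fun x => proj₁ (ε x)) <|
    pair (fn fun x => fn fun y => fn fun z => fn fun f => fn fun g => proj₁ (κ x y z f g))
      (lawsTm O A I K R ε κ))
    (tySet O)

/-- The element `x` of a set `X`, with a proof of `x = x`. -/
def singletonSelf (X x : PTm) : PTm :=
  pair x (untrunc.apps [id (ty X) x x, levelProp.apps [id (ty X) x x, pathLevel X x x],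
    truncIn (pair rfl star)])

/-- A strict category is recovered from its model. -/
def ofModelToModel : PTm :=
  fn fun _ => split fun _ _ => revert <| split fun C _ => split fun H _ => split fun e _ =>
  split fun c l => fn fun hC =>
  let O := pair C hC
  let c' : PTm → PTm → PTm → PTm → PTm → PTm := fun x y z f g => c.apps [x, y, z, f, g]
  -- The laws produced by the round trip, with the chosen elements already computed; `singletonSelf`
  -- is the form to which they reduce.
  let l' := lawsTm O H (idnRelFn H (app e)) (cmpRelFn H c') (restLemma.apps [O, H, e, c, l])
    (fun x => singletonSelf (H.apps [x, x]) (app e x))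
    (fun x y z f g => singletonSelf (H.apps [x, z]) (c' x y z f g))
  ap.apps [lawsOf O H (app e) c', StrCat 0,
    fn fun l => pair (pair C <| pair H <| pair e <| pair c l) hC, l', l,
    lawsProp.apps [O, H, e, c, l', l]]

/-- A model is recovered from its strict category. -/
def toModelOfModel : PTm :=
  -- The set of objects is split too, since pairs have no judgmental uniqueness rule: only for an
  -- explicit pair is the reassembled set convertible to the original one.
  fn fun _ => split fun _ _ => revert <| split fun C hC => fn fun _ => split fun A _ =>
  split fun I _ => split fun K _ => split fun a _ => split fun b R =>
  let O := pair C hC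
  let ε : PTm → PTm := idnSig O A I K R a
  let κ : PTm → PTm → PTm → PTm → PTm → PTm := cmpSig O A I K R b
  let e : PTm → PTm := fun x => proj₁ (ε x)
  let c : PTm → PTm → PTm → PTm → PTm → PTm := fun x y z f g => proj₁ (κ x y z f g)
  modelPath.apps [O, A, I, K, pair a (pair b R), R, fn ε,
    fn fun x => fn fun y => fn fun z => fn fun f => fn fun g => κ x y z f g,
    modelAx O A e c (lawsTm O A I K R ε κ)]

def mainT : PTm := equiv (StrCat 0) modT

def mainP : PTm :=
  pair toModel (pair (pair ofModel toModelOfModel) (pair ofModel ofModelToModel))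

end HoTT.PTm

-- The derivation in the lowest universe and its transfer to all universes.

namespace HoTT

open PTm

/-- The equivalence and the lemmas for it, with proofs, the last one first. -/
def equivalence : List (PTm × PTm) :=
  [(mainT, mainP), (modelPathT, modelPathP), (cmpRelEqT, cmpRelEqP), (idnRelEqT, idnRelEqP),
    (restLemmaT, restLemmaP), (lawsT, lawsP), (lawsPropT, lawsPropP), (axPropT, axPropP), (cmpUniqueT, cmpUniqueP),
    (idnUniqueT, idnUniqueP), (idnEqT, idnEqP), (cmpEqT, cmpEqP), (uniqueT, uniqueP),
    (untruncT, untruncP)]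

theorem inhabited_equivalence :
    Inhabited (context (equivalence.map Prod.fst ++ (basics.map Prod.fst ++ []))) :=
  inhabited_basics.append equivalence (by decide +kernel)

theorem exists_hasType_equiv : ∃ a, HasType [] a
    (equiv (StrCat 0) (FOLiso.Mod FOLiso.Lstrcat 0 FOLiso.Tstrcat) 0) := by
  -- The main statement comes after 32 lemmas: 19 basic ones and 13 on categories and models.
  have h : ∃ a, HasType [] a (mainT 32) := inhabited_equivalence.exists (by decide +kernel)
  -- Being closed, the statement is the same raw term at depth `32` as at depth `0`. The
  -- hand-written type of models is also the same raw term as the one computed from the signature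
  -- and the theory.
  rwa [Tm.eq_of_beq (a := mainT 32)
    (b := equiv (StrCat 0) (FOLiso.Mod FOLiso.Lstrcat 0 FOLiso.Tstrcat) 0) (by decide +kernel)] at h

end HoTT

theorem mainTheorem6 (i : ℕ) :
    HoTT.IsInhabited (HoTT.PTm.equiv (HoTT.PTm.StrCat i)
      (FOLiso.Mod FOLiso.Lstrcat i FOLiso.Tstrcat)) := by
  obtain ⟨a, ha⟩ := HoTT.exists_hasType_equiv
  -- Both types at level `0` mention no universe other than `U₀`, so raising levels by `i` turns
  -- them, by computation, into the types at level `i`.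
  exact ⟨_, ha.lift i⟩
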